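/- Let $M$ be a compact oriented Riemannian manifold of dimension $n$ (for instance $n=2m$), on which a Lie group $G$ with Lie algebra $\mathfrak g$ acts by orientation preserving isometries, and let $SOF(M)\to M$ be the principal $SO(n)$-bundle of oriented orthonormal frames. Let $P\to SOF(M)\to M$ be a $G$-equivariant spin$^c$ structure on $M$: $\pi\colon P\to M$ is a principal $Spin^c(n)$-bundle, where $Spin^c(n)=(Spin(n)\times U(1))/\{(1,1),(-1,-1)\}$, with a left $G$-action commuting with the $Spin^c(n)$-action, and $P\to SOF(M)$ is a $G$-equivariant map over $M$ that intertwines the $Spin^c(n)$- and $SO(n)$-actions along $\lambda^c\colon Spin^c(n)\to SO(n)$, $[x,z]\mapsto(y\mapsto xyx^{-1})$. (All manifolds, maps and actions are smooth.) Let $\theta\colon TP\to\mathfrak u(1)=i\mathbb R$ be a $G$-invariant and $Spin^c(n)$-invariant connection 1-form on the principal $U(1)$-bundle $P\to SOF(M)$ such that, for every $\zeta\in\mathfrak{spin}(n)$, the function $\theta(\zeta_P)$ is constant on $P$, where $\zeta_P$ is the vector field on $P$ generated by $\zeta$. For $\xi\in\mathfrak g$ let $\xi_P,\xi_M$ be the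 vector fields on $P$ and $M$ generated by $\xi$, and put $\phi^\xi=-i\,\iota_{\xi_P}\theta\colon P\to\mathbb R$. Then: 1. For every $\xi\in\mathfrak g$ the function $\phi^\xi$ is $Spin^c(n)$-invariant, and $\phi^\xi=\pi^*\Phi^\xi$ for a unique function $\Phi^\xi\colon M\to\mathbb R$, which is smooth. 2. There is a unique real two-form $\omega$ on $M$ with $d\theta=\pi^*(-i\,\omega)$; it is smooth, and $d\Phi^\xi=\iota_{\xi_M}\omega$ for every $\xi\in\mathfrak g$. 3. $\Phi^\xi$ is linear in $\xi$, and the map $\Phi\colon M\to\mathfrak g^*$, $\Phi(x)(\xi)=\Phi^\xi(x)$, is $G$-equivariant for the coadjoint action: $\Phi(g\cdot x)(\xi)=\Phi(x)(\mathrm{Ad}_{g^{-1}}\xi)$. Thus $\Phi$ satisfies the moment map conditions for the action of $G$ on $(M,\omega)$. -/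

import Mathlib

open scoped Manifold ContDiff Topology
open Filter

noncomputable section

/-! ### Differential forms on manifolds without boundary -/

/-- `F`-valued differential `k`-forms on `M` (pointwise data, see `IsSmoothForm`). -/
abbrev DForm {E : Type*} [NormedAddCommGroup E] [NormedSpace ℝ E] {H : Type*} [TopologicalSpace H]
    (I : ModelWithCorners ℝ E H) (M : Type*) [TopologicalSpace M] [ChartedSpace H M]
    (k : ℕ) (F : Type*) [NormedAddCommGroup F] [NormedSpace ℝ F] :=
  (x : M) → (TangentSpace I x) [⋀^Fin k]→L[ℝ] F

section Forms

variable {E : Type*} [NormedAddCommGroup E] [NormedSpace ℝ E] {H : Type*} [TopologicalSpace H]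
  {I : ModelWithCorners ℝ E H} {M : Type*} [TopologicalSpace M] [ChartedSpace H M]
  {k : ℕ} {F : Type*} [NormedAddCommGroup F] [NormedSpace ℝ F]

/-- The coordinate expression of a form in the chart at `x₀`: its pull-back under the inverse of
the chart, a form on the target of the chart. -/
def DForm.inChart (α : DForm I M k F) (x₀ : M) (y : E) : E [⋀^Fin k]→L[ℝ] F :=
  (α ((extChartAt I x₀).symm y)).compContinuousLinearMap
    (mfderiv 𝓘(ℝ, E) I (extChartAt I x₀).symm y)

/-- A form is smooth if all its coordinate expressions are. -/
def IsSmoothForm (α : DForm I M k F) : Prop :=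
  ∀ x₀ : M, ContDiffOn ℝ ∞ (α.inChart x₀) (extChartAt I x₀).target

/-- The exterior derivative, computed at `x` in the chart at `x`. -/
def DForm.d (α : DForm I M k F) : DForm I M (k + 1) F := fun x =>
  (extDeriv (α.inChart x) (extChartAt I x x)).compContinuousLinearMap
    (mfderiv I 𝓘(ℝ, E) (extChartAt I x) x)

end Forms

/-! ### Lie groups acting on manifolds -/

section Actions

variable {EG : Type*} [NormedAddCommGroup EG] [NormedSpace ℝ EG]
  {HG : Type*} [TopologicalSpace HG] (IG : ModelWithCorners ℝ EG HG)
  {G : Type*} [TopologicalSpace G] [ChartedSpace HG G] [Group G]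
  {E : Type*} [NormedAddCommGroup E] [NormedSpace ℝ E]
  {H : Type*} [TopologicalSpace H] (I : ModelWithCorners ℝ E H)
  {N : Type*} [TopologicalSpace N] [ChartedSpace H N] [MulAction G N]

/-- The vector field `ξ_N` on `N` generated by `ξ ∈ Lie(G)`: its value at `x` is the image of `ξ`
under the differential at `1` of the orbit map `h ↦ h • x`, i.e. `d/dt|₀ exp(tξ) • x`. -/
def generatedField (ξ : GroupLieAlgebra IG G) (x : N) : TangentSpace I x :=
  mfderiv IG I (fun h : G => h • x) 1 ξ

/-- The adjoint representation: the differential at `1` of conjugation `k ↦ h k h⁻¹`. -/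
def adjointRep (h : G) : GroupLieAlgebra IG G →L[ℝ] GroupLieAlgebra IG G :=
  mfderiv IG IG (fun k : G => h * k * h⁻¹) 1

/-- The coadjoint action on `Lie(G)*`: `(h • μ)(ξ) = μ (Ad_{h⁻¹} ξ)`. -/
def coadjoint (h : G) (μ : GroupLieAlgebra IG G →L[ℝ] ℝ) : GroupLieAlgebra IG G →L[ℝ] ℝ :=
  μ.comp (adjointRep IG h⁻¹)

end Actions

/-! ### The groups `Spin(n)` and `Spin^c(n)` -/

/-- Minus the square of the standard Euclidean norm on `ℝⁿ`. -/
def negQ (n : ℕ) : QuadraticForm ℝ (EuclideanSpace ℝ (Fin n)) :=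
  -LinearMap.BilinMap.toQuadraticMap (innerₗ (EuclideanSpace ℝ (Fin n)))

/-- The real Clifford algebra `C_n`, in which `v * v = -‖v‖²` for `v ∈ ℝⁿ`. -/
abbrev Cl (n : ℕ) := CliffordAlgebra (negQ n)

/-- The spin group: products of an even number of unit vectors in `C_n`. -/
abbrev Spin (n : ℕ) := spinGroup (negQ n)

theorem exteriorAlgebra_finite (V : Type*) [AddCommGroup V] [Module ℝ V] [Module.Finite ℝ V] :
    Module.Finite ℝ (ExteriorAlgebra ℝ V) := by
  have htop : (⨆ i : ℕ, (⋀[ℝ]^i V : Submodule ℝ (ExteriorAlgebra ℝ V))) = ⊤ :=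
    (DirectSum.Decomposition.isInternal
      (fun i : ℕ => (⋀[ℝ]^i V : Submodule ℝ (ExteriorAlgebra ℝ V)))).submodule_iSup_eq_top
  have hle : (⨆ i : ℕ, (⋀[ℝ]^i V : Submodule ℝ (ExteriorAlgebra ℝ V))) ≤
      ⨆ i : Fin (Module.finrank ℝ V + 1), ⋀[ℝ]^(i : ℕ) V := by
    refine iSup_le fun i => ?_
    by_cases hi : i < Module.finrank ℝ V + 1
    · exact le_iSup (fun i : Fin (Module.finrank ℝ V + 1) =>
        (⋀[ℝ]^(i : ℕ) V : Submodule ℝ (ExteriorAlgebra ℝ V))) ⟨i, hi⟩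
    · have h0 : Module.finrank ℝ (⋀[ℝ]^i V) = 0 := by
        rw [exteriorPower.finrank_eq]
        exact Nat.choose_eq_zero_of_lt (by omega)
      have hb : (⋀[ℝ]^i V : Submodule ℝ (ExteriorAlgebra ℝ V)) = ⊥ :=
        Submodule.finrank_eq_zero.mp h0
      rw [hb]
      exact bot_le
  rw [Module.finite_def, ← top_le_iff.mp (htop ▸ hle)]
  exact Submodule.fg_iSup _ fun i => Module.Finite.iff_fg.mp inferInstance

instance instFiniteCl (n : ℕ) : Module.Finite ℝ (Cl n) :=
  haveI := exteriorAlgebra_finite (EuclideanSpace ℝ (Fin n))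
  Module.Finite.equiv (CliffordAlgebra.equivExterior (negQ n)).symm

/-- A norm on the finite-dimensional space `C_n`, from the coordinates in a basis. Only the
topology and the smooth structure matter, and these do not depend on the choice. -/
instance instNormCl (n : ℕ) : NormedAddCommGroup (Cl n) :=
  NormedAddCommGroup.induced (Cl n) (Fin (Module.finrank ℝ (Cl n)) → ℝ)
    (Module.finBasis ℝ (Cl n)).equivFun (Module.finBasis ℝ (Cl n)).equivFun.injective

instance instNormedSpaceCl (n : ℕ) : NormedSpace ℝ (Cl n) :=
  NormedSpace.induced ℝ (Cl n) (Fin (Module.finrank ℝ (Cl n)) → ℝ)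
    (Module.finBasis ℝ (Cl n)).equivFun

/-- The projection of `C_n` to its subspace `ℝⁿ`. -/
def vectorPart (n : ℕ) : Cl n →ₗ[ℝ] EuclideanSpace ℝ (Fin n) :=
  ExteriorAlgebra.ιInv ∘ₗ (CliffordAlgebra.equivExterior (negQ n)).toLinearMap

/-- The double covering `λ : Spin(n) → SO(n)`, `λ(x) y = x y xᵗ`, where `xᵗ` reverses products of
vectors. As `x y xᵗ` lies in `ℝⁿ` (see `ι_spinCover`), `vectorPart` only forgets the embedding. -/
def spinCover {n : ℕ} (x : Spin n) :
    EuclideanSpace ℝ (Fin n) →ₗ[ℝ] EuclideanSpace ℝ (Fin n) :=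
  vectorPart n ∘ₗ LinearMap.mulRight ℝ (CliffordAlgebra.reverse (x : Cl n)) ∘ₗ
    LinearMap.mulLeft ℝ (x : Cl n) ∘ₗ CliffordAlgebra.ι (negQ n)

theorem vectorPart_ι (n : ℕ) (y : EuclideanSpace ℝ (Fin n)) :
    vectorPart n (CliffordAlgebra.ι (negQ n) y) = y := by
  have h : CliffordAlgebra.equivExterior (negQ n) (CliffordAlgebra.ι (negQ n) y) =
      ExteriorAlgebra.ι ℝ y :=
    CliffordAlgebra.changeForm_ι CliffordAlgebra.changeForm.associated_neg_proof y
  simp only [vectorPart, LinearMap.comp_apply, LinearEquiv.coe_coe, h]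
  exact ExteriorAlgebra.ι_leftInverse y

theorem ι_spinCover {n : ℕ} (x : Spin n) (y : EuclideanSpace ℝ (Fin n)) :
    CliffordAlgebra.ι (negQ n) (spinCover x y) =
      (x : Cl n) * CliffordAlgebra.ι (negQ n) y * CliffordAlgebra.reverse (x : Cl n) := by
  have hrev : CliffordAlgebra.reverse (x : Cl n) = star (x : Cl n) := by
    rw [CliffordAlgebra.star_def, spinGroup.involute_eq x.2]
  have hx : ((spinGroup.toUnits x : (Cl n)ˣ) : Cl n) ∈ spinGroup (negQ n) := x.2
  obtain ⟨w, hw⟩ := spinGroup.conjAct_smul_ι_mem_range_ι hx y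
  have hw' : (x : Cl n) * CliffordAlgebra.ι (negQ n) y * CliffordAlgebra.reverse (x : Cl n) =
      CliffordAlgebra.ι (negQ n) w := by
    rw [hw, hrev]
    rfl
  have : spinCover x y = vectorPart n
      ((x : Cl n) * CliffordAlgebra.ι (negQ n) y * CliffordAlgebra.reverse (x : Cl n)) := rfl
  rw [this, hw', vectorPart_ι]

/-- The subgroup `{(1, 1), (-1, -1)}` of `Spin(n) × U(1)`. -/
def spinKernel (n : ℕ) : Subgroup (Spin n × Circle) where
  carrier := {h | ((h.1 : Cl n) = 1 ∧ (h.2 : ℂ) = 1) ∨ ((h.1 : Cl n) = -1 ∧ (h.2 : ℂ) = -1)}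
  one_mem' := by simp
  mul_mem' := by
    rintro ⟨a, z⟩ ⟨b, w⟩ (⟨h1, h2⟩ | ⟨h1, h2⟩) (⟨h3, h4⟩ | ⟨h3, h4⟩) <;> dsimp only at h1 h2 h3 h4
    · exact Or.inl ⟨by simp [h1, h3], by simp [h2, h4]⟩
    · exact Or.inr ⟨by simp [h1, h3], by simp [h2, h4]⟩
    · exact Or.inr ⟨by simp [h1, h3], by simp [h2, h4]⟩
    · exact Or.inl ⟨by simp [h1, h3], by simp [h2, h4]⟩
  inv_mem' := by
    rintro ⟨a, z⟩ (⟨h1, h2⟩ | ⟨h1, h2⟩) <;> dsimp only at h1 h2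
    · exact Or.inl ⟨by simp [← spinGroup.star_eq_inv, h1], by simp [h2]⟩
    · exact Or.inr ⟨by simp [← spinGroup.star_eq_inv, h1], by simp [h2, inv_neg]⟩

instance (n : ℕ) : (spinKernel n).Normal where
  conj_mem := by
    rintro ⟨a, z⟩ h ⟨b, w⟩
    have hb : (b : Cl n) * ((b⁻¹ : Spin n) : Cl n) = 1 := congrArg Subtype.val (mul_inv_cancel b)
    rcases h with ⟨h1, h2⟩ | ⟨h1, h2⟩ <;> dsimp only at h1 h2
    · exact Or.inl ⟨by simp [h1, hb], by simp [h2]⟩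
    · exact Or.inr ⟨by simp [h1, hb], by simp [h2]⟩

/-- The group `Spin^c(n) = (Spin(n) × U(1)) / {(1, 1), (-1, -1)}`. -/
abbrev SpinC (n : ℕ) := (Spin n × Circle) ⧸ spinKernel n

/-- The class `[x, z] ∈ Spin^c(n)` of `(x, z) ∈ Spin(n) × U(1)`. -/
def SpinC.mk {n : ℕ} (x : Spin n) (z : Circle) : SpinC n := QuotientGroup.mk (x, z)

/-- The homomorphism `λ^c : Spin^c(n) → SO(n)`, `[x, z] ↦ λ(x)`. -/
def spinCCover {n : ℕ} (γ : SpinC n) :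
    EuclideanSpace ℝ (Fin n) →ₗ[ℝ] EuclideanSpace ℝ (Fin n) :=
  Quotient.liftOn' γ (fun h => spinCover h.1) (by
    rintro ⟨a, z⟩ ⟨b, w⟩ h
    have hk : (a, z)⁻¹ * (b, w) ∈ spinKernel n := QuotientGroup.leftRel_apply.mp h
    have hab : (b : Cl n) = (a : Cl n) * ((a⁻¹ * b : Spin n) : Cl n) :=
      congrArg Subtype.val (mul_inv_cancel_left a b).symm
    rcases hk with ⟨h1, -⟩ | ⟨h1, -⟩
    · have h1' : ((a⁻¹ * b : Spin n) : Cl n) = 1 := h1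
      have : a = b := Subtype.ext (by rw [hab, h1', mul_one])
      rw [this]
    · have h1' : ((a⁻¹ * b : Spin n) : Cl n) = -1 := h1
      have hb : (b : Cl n) = -(a : Cl n) := by rw [hab, h1', mul_neg_one]
      ext1 y
      simp [spinCover, hb])

/-! ### Smoothness for `Spin(n)` and `Spin^c(n)`

`Spin(n) × U(1)` is regarded as a closed embedded submanifold of the vector space `C_n × ℂ`; a map
into it is smooth if it is smooth as a map into `C_n × ℂ`, and a map on it is smooth if it extends
locally to a smooth map on `C_n × ℂ`. Smoothness for `Spin^c(n)` is smoothness through the covering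
`Spin(n) × U(1) → Spin^c(n)`, which is a local diffeomorphism. -/

/-- Smoothness at a point of a map into `Spin^c(n)`: it lifts near the point to a smooth map into
`Spin(n) × U(1)`. -/
def SmoothIntoSpinCAt {n : ℕ} {E : Type*} [NormedAddCommGroup E] [NormedSpace ℝ E]
    {H : Type*} [TopologicalSpace H] (I : ModelWithCorners ℝ E H)
    {N : Type*} [TopologicalSpace N] [ChartedSpace H N] (κ : N → SpinC n) (q₀ : N) : Prop :=
  ∃ W : Set N, IsOpen W ∧ q₀ ∈ W ∧ ∃ (x : N → Spin n) (z : N → Circle),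
    ContMDiffOn I 𝓘(ℝ, Cl n × ℂ) ∞ (fun q => ((x q : Cl n), (z q : ℂ))) W ∧
    ∀ q ∈ W, κ q = SpinC.mk (x q) (z q)

/-- `c` is a smooth curve in `Spin(n)` through `1` whose velocity at time `0` is `ζ`. -/
def RepresentsSpin {n : ℕ} (c : ℝ → Spin n) (ζ : Cl n) : Prop :=
  ContDiff ℝ ∞ (fun t => (c t : Cl n)) ∧ c 0 = 1 ∧ HasDerivAt (fun t => (c t : Cl n)) ζ 0

/-- The Lie algebra `𝔰𝔭𝔦𝔫(n) = T_1 Spin(n)`, as a subset of `C_n`. -/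
def spinLie (n : ℕ) : Set (Cl n) := {ζ | ∃ c : ℝ → Spin n, RepresentsSpin c ζ}

/-! ### Principal `Spin^c(n)`-bundles -/

/-- The right action `p · γ` of `γ ∈ Spin^c(n)` on `p ∈ P`. -/
def rightAct {n : ℕ} {P : Type*} [MulAction (SpinC n)ᵐᵒᵖ P]
    (p : P) (γ : SpinC n) : P := MulOpposite.op γ • p

/-- `π : P → M` is a (smooth) principal `Spin^c(n)`-bundle. -/
structure IsPrincipalSpinC (n : ℕ) {M : Type*} [TopologicalSpace M]
    [ChartedSpace (EuclideanSpace ℝ (Fin n)) M]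
    (EP : Type*) [NormedAddCommGroup EP] [NormedSpace ℝ EP]
    {P : Type*} [TopologicalSpace P] [ChartedSpace EP P] [MulAction (SpinC n)ᵐᵒᵖ P]
    (π : P → M) : Prop where
  smooth_proj : ContMDiff 𝓘(ℝ, EP) (𝓡 n) ∞ π
  proj_rightAct : ∀ (p : P) (γ : SpinC n), π (rightAct p γ) = π p
  /-- The right action `P × Spin^c(n) → P` is smooth: near each point, `(p, x, z) ↦ p · [x, z]`
  extends to a smooth map on an open subset of `P × C_n × ℂ`. -/
  smooth_rightAct : ∀ (p : P) (x : Spin n) (z : Circle),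
    ∃ W : Set (P × (Cl n × ℂ)), IsOpen W ∧ (p, ((x : Cl n), (z : ℂ))) ∈ W ∧
    ∃ f : P × (Cl n × ℂ) → P,
      ContMDiffOn (𝓘(ℝ, EP).prod 𝓘(ℝ, Cl n × ℂ)) 𝓘(ℝ, EP) ∞ f W ∧
      ∀ (q : P) (y : Spin n) (w : Circle), (q, ((y : Cl n), (w : ℂ))) ∈ W →
        f (q, ((y : Cl n), (w : ℂ))) = rightAct q (SpinC.mk y w)
  /-- Local triviality: over a neighbourhood `U` of each point there is a smooth section `s` such
  that `(y, γ) ↦ s(y) · γ` is a diffeomorphism `U × Spin^c(n) → π⁻¹(U)`; its inverse is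
  `p ↦ (π p, κ p)`. -/
  locally_trivial : ∀ x : M, ∃ U : Set M, IsOpen U ∧ x ∈ U ∧
    ∃ (s : M → P) (κ : P → SpinC n),
      ContMDiffOn (𝓡 n) 𝓘(ℝ, EP) ∞ s U ∧
      (∀ y ∈ U, π (s y) = y) ∧
      (∀ p, π p ∈ U → rightAct (s (π p)) (κ p) = p) ∧
      (∀ y ∈ U, ∀ γ, κ (rightAct (s y) γ) = γ) ∧
      ∀ p, π p ∈ U → SmoothIntoSpinCAt 𝓘(ℝ, EP) κ p

/-! ### Oriented orthonormal frames and spin^c structures -/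

section Frames

variable {n : ℕ} {M : Type*} [TopologicalSpace M] [ChartedSpace (EuclideanSpace ℝ (Fin n)) M]
  [IsManifold (𝓡 n) ∞ M]

/-- Riemannian metrics on an `n`-dimensional manifold. -/
abbrev Metric (n : ℕ) (M : Type*) [TopologicalSpace M] [ChartedSpace (EuclideanSpace ℝ (Fin n)) M]
    [IsManifold (𝓡 n) ∞ M] :=
  Bundle.ContMDiffRiemannianMetric (𝓡 n) ∞ (EuclideanSpace ℝ (Fin n))
    (fun x : M => TangentSpace (𝓡 n) x)

/-- An orientation of an `n`-dimensional manifold, given by a nowhere vanishing smooth `n`-form: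
a basis of a tangent space is positively oriented if the form is positive on it. -/
def IsOrientation (vol : DForm (𝓡 n) M n ℝ) : Prop :=
  IsSmoothForm vol ∧ ∀ x, vol x ≠ 0

/-- The bundle `SOF(M)` of oriented orthonormal frames; a frame at `x` is an isometry
`ℝⁿ → T_x M` which maps the standard basis to a positively oriented one. -/
structure SOF (g : Metric n M) (vol : DForm (𝓡 n) M n ℝ) where
  base : M
  frame : EuclideanSpace ℝ (Fin n) →ₗ[ℝ] TangentSpace (𝓡 n) base
  isometry : ∀ u v, g.inner base (frame u) (frame v) = inner ℝ u v
  positive : 0 < vol base (fun i => frame (EuclideanSpace.single i 1))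

/-- The tangent vector to `M` with coordinates `u` in a given frame. -/
def SOF.vec {g : Metric n M} {vol : DForm (𝓡 n) M n ℝ} (q : SOF g vol)
    (u : EuclideanSpace ℝ (Fin n)) : TangentBundle (𝓡 n) M :=
  ⟨q.base, q.frame u⟩

/-- `G` acts on `M` by orientation preserving isometries. -/
def ActsByOrientedIsometries (G : Type*) [Group G] [MulAction G M] (g : Metric n M)
    (vol : DForm (𝓡 n) M n ℝ) : Prop :=
  ∀ (h : G) (x : M),
    (∀ u v : TangentSpace (𝓡 n) x,
      g.inner (h • x) (mfderiv (𝓡 n) (𝓡 n) (fun y : M => h • y) x u)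
        (mfderiv (𝓡 n) (𝓡 n) (fun y : M => h • y) x v) = g.inner x u v) ∧
    ∀ f : Fin n → TangentSpace (𝓡 n) x, 0 < vol x f →
      0 < vol (h • x) (fun i => mfderiv (𝓡 n) (𝓡 n) (fun y : M => h • y) x (f i))

variable {g : Metric n M} {vol : DForm (𝓡 n) M n ℝ}

/-- The bundle projection `π : P → SOF(M) → M`. -/
def baseProj {P : Type*} (Λ : P → SOF g vol) (p : P) : M := (Λ p).base

/-- `Λ : P → SOF(M)` is a `G`-equivariant spin^c structure on `M`, for given actions of `G` and of
`Spin^c(n)` on `P`. The group `SO(n)` acts on frames by precomposition and `G` acts on frames by the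
differential of its action on `M`. A map into `SOF(M)` is smooth if all vectors of the frame
depend smoothly on the argument. -/
structure IsEquivariantSpinCStructure (G : Type*) [Group G] [MulAction G M]
    (EP : Type*) [NormedAddCommGroup EP] [NormedSpace ℝ EP]
    {P : Type*} [TopologicalSpace P] [ChartedSpace EP P] [MulAction (SpinC n)ᵐᵒᵖ P] [MulAction G P]
    (Λ : P → SOF g vol) : Prop where
  principal : IsPrincipalSpinC n EP (baseProj Λ)
  smooth : ∀ u, ContMDiff 𝓘(ℝ, EP) (𝓡 n).tangent ∞ (fun p => (Λ p).vec u)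
  spinC_equivariant : ∀ (p : P) (γ : SpinC n) (u : EuclideanSpace ℝ (Fin n)),
    (Λ (rightAct p γ)).vec u = (Λ p).vec (spinCCover γ u)
  group_equivariant : ∀ (h : G) (p : P) (u : EuclideanSpace ℝ (Fin n)),
    (Λ (h • p)).vec u = tangentMap (𝓡 n) (𝓡 n) (fun y : M => h • y) ((Λ p).vec u)
  commute : ∀ (h : G) (p : P) (γ : SpinC n), h • rightAct p γ = rightAct (h • p) γ

end Frames

/-! ### Invariant connections on `P → SOF(M)` -/

/-- The velocity `d/dt|₀ p · γ(t)` of a curve `γ` in `Spin^c(n)` with `γ(0) = 1`, acting on `p`.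
(The base point `p · γ(0)` of the tangent space is `p`.) -/
def orbitVelocity {n : ℕ} {EP : Type*} [NormedAddCommGroup EP] [NormedSpace ℝ EP]
    {P : Type*} [TopologicalSpace P] [ChartedSpace EP P] [MulAction (SpinC n)ᵐᵒᵖ P]
    (γ : ℝ → SpinC n) (p : P) : TangentSpace 𝓘(ℝ, EP) p :=
  mfderiv 𝓘(ℝ, ℝ) 𝓘(ℝ, EP) (fun t : ℝ => rightAct p (γ t)) 0 (1 : ℝ)

/-- `θ` is a connection 1-form on the principal `U(1)`-bundle `P → SOF(M)` (where `z ∈ U(1)` acts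
as `[1, z]`), invariant under `G` and `Spin^c(n)`. It takes values in `𝔲(1) = iℝ ⊆ ℂ`. -/
structure IsInvariantConnection (n : ℕ) {EP : Type*} [NormedAddCommGroup EP] [NormedSpace ℝ EP]
    {P : Type*} [TopologicalSpace P] [ChartedSpace EP P] [MulAction (SpinC n)ᵐᵒᵖ P]
    (G : Type*) [Group G] [MulAction G P] (θ : DForm 𝓘(ℝ, EP) P 1 ℂ) : Prop where
  smooth : IsSmoothForm θ
  imaginary : ∀ (p : P) (v : TangentSpace 𝓘(ℝ, EP) p), (θ p ![v]).re = 0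
  /-- `θ(b_P) = b` for `b ∈ 𝔲(1)`, written `b = ir`. -/
  vertical : ∀ (r : ℝ) (p : P),
    θ p ![orbitVelocity (fun t => SpinC.mk (n := n) 1 (Circle.exp (t * r))) p] = Complex.I * r
  spinC_invariant : ∀ (γ : SpinC n) (p : P) (v : TangentSpace 𝓘(ℝ, EP) p),
    θ (rightAct p γ) ![mfderiv 𝓘(ℝ, EP) 𝓘(ℝ, EP) (fun q : P => rightAct q γ) p v] = θ p ![v]
  group_invariant : ∀ (h : G) (p : P) (v : TangentSpace 𝓘(ℝ, EP) p),
    θ (h • p) ![mfderiv 𝓘(ℝ, EP) 𝓘(ℝ, EP) (fun q : P => h • q) p v] = θ p ![v]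

/-- For every `ζ ∈ 𝔰𝔭𝔦𝔫(n)`, the function `θ(ζ_P)` is constant on `P`. The value of `ζ_P` at `p` is
`d/dt|₀ p · c(t)` for any curve `c` in `Spin(n)` representing `ζ`. -/
def ConstantOnSpin (n : ℕ) {EP : Type*} [NormedAddCommGroup EP] [NormedSpace ℝ EP]
    {P : Type*} [TopologicalSpace P] [ChartedSpace EP P] [MulAction (SpinC n)ᵐᵒᵖ P]
    (θ : DForm 𝓘(ℝ, EP) P 1 ℂ) : Prop :=
  ∀ ζ ∈ spinLie n, ∃ a : ℂ, ∀ c : ℝ → Spin n, RepresentsSpin c ζ →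
    ∀ p : P, θ p ![orbitVelocity (fun t => SpinC.mk (c t) 1) p] = a

/-- `φ^ξ = -i · θ(ξ_P)`, as a function with values in `ℂ`. -/
def phi {EG : Type*} [NormedAddCommGroup EG] [NormedSpace ℝ EG]
    {G : Type*} [TopologicalSpace G] [ChartedSpace EG G] [Group G]
    {EP : Type*} [NormedAddCommGroup EP] [NormedSpace ℝ EP]
    {P : Type*} [TopologicalSpace P] [ChartedSpace EP P] [MulAction G P]
    (θ : DForm 𝓘(ℝ, EP) P 1 ℂ) (ξ : GroupLieAlgebra 𝓘(ℝ, EG) G) (p : P) : ℂ :=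
  -Complex.I * θ p ![generatedField 𝓘(ℝ, EG) 𝓘(ℝ, EP) ξ p]

/-- The equation `dθ = π^*(-i·Ω)` between 2-forms on `P`. -/
def IsCurvature {n : ℕ} {M : Type*} [TopologicalSpace M]
    [ChartedSpace (EuclideanSpace ℝ (Fin n)) M]
    {EP : Type*} [NormedAddCommGroup EP] [NormedSpace ℝ EP]
    {P : Type*} [TopologicalSpace P] [ChartedSpace EP P]
    (π : P → M) (θ : DForm 𝓘(ℝ, EP) P 1 ℂ) (Ω : DForm (𝓡 n) M 2 ℝ) : Prop :=
  ∀ (p : P) (u v : TangentSpace 𝓘(ℝ, EP) p),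
    θ.d p ![u, v] = -Complex.I *
      ((Ω (π p) ![mfderiv 𝓘(ℝ, EP) (𝓡 n) π p u, mfderiv 𝓘(ℝ, EP) (𝓡 n) π p v] : ℝ) : ℂ)

end

/-!
The curvature `dθ` of an invariant connection is a basic form on `P`, and everything else follows
from Cartan's formula `ι_X dθ = L_X θ - d(ι_X θ)` for vector fields `X` which generate a family of
maps preserving `θ`, so that `L_X θ = 0` (`IsSmoothForm.d_velocity_apply`).

For `X = V_P` with `V` in the Lie algebra of `Spin^c(n)`, the function `θ(V_P)` is constant: on the
`𝔰𝔭𝔦𝔫(n)`-part by hypothesis, on the `𝔲(1)`-part because `θ` is a connection. Hence `ι_{V_P} dθ = 0`.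
The kernel of `dπ` consists of such vectors
(`IsPrincipalSpinC.exists_orbitVelocity_of_mem_ker`), so `dθ` is horizontal; being also
`Spin^c(n)`-invariant, it descends to `-i · Ω` with `Ω = i · s^* dθ` for any local section `s`
(`IsInvariantConnection.exists_isCurvature`). This formula gives the smoothness and the uniqueness
of `Ω`.

For `X = ξ_P` with `ξ ∈ 𝔤`, Cartan's formula reads `ι_{ξ_P} dθ = -d(θ(ξ_P)) = -i dφ^ξ`, and `ξ_P`
projects to `ξ_M`; pulled back by a local section, this is `dΦ^ξ = ι_{ξ_M} Ω`
(`IsInvariantConnection.moment_map`). The invariance of `φ^ξ` under `Spin^c(n)` and the equivariance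
of `Φ` follow from the invariance of `θ` and the behaviour of generated vector fields under
equivariant maps.

Lie derivatives and flows are avoided. A form is pulled back along a map from a vector space,
`f(t, z) = φ_t(σ(z))`, where the exterior derivative is given by partial derivatives
(`IsSmoothForm.extDeriv_pullback`, `extDeriv_one_form_apply`). Instead of one-parameter groups, any
curve `t ↦ c(t)` in the group with the right velocity at the identity is used.
-/

noncomputable section

/-! ### Pulling forms back to vector spaces -/

section Pullback

variable {E : Type*} [NormedAddCommGroup E] [NormedSpace ℝ E]
  {N : Type*} [TopologicalSpace N] [ChartedSpace E N]
  {E' : Type*} [NormedAddCommGroup E'] [NormedSpace ℝ E']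
  {k : ℕ} {F : Type*} [NormedAddCommGroup F] [NormedSpace ℝ F]

/-- The pull-back of a form on a manifold under a map defined on a vector space. -/
def DForm.pullback (θ : DForm 𝓘(ℝ, E) N k F) (f : E' → N) (y : E') : E' [⋀^Fin k]→L[ℝ] F :=
  (θ (f y)).compContinuousLinearMap (mfderiv 𝓘(ℝ, E') 𝓘(ℝ, E) f y)

theorem DForm.inChart_eq_pullback (θ : DForm 𝓘(ℝ, E) N k F) (p : N) :
    θ.inChart p = θ.pullback (extChartAt 𝓘(ℝ, E) p).symm := rfl

/-- All tangent spaces are the model space `E`, so values at equal points can be compared. -/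
theorem DForm.apply_congr (θ : DForm 𝓘(ℝ, E) N k F) {p q : N} (h : p = q) (v : Fin k → E) :
    (show E [⋀^Fin k]→L[ℝ] F from θ p) v = (show E [⋀^Fin k]→L[ℝ] F from θ q) v := by
  rw [h]

theorem DForm.pullback_congr (θ : DForm 𝓘(ℝ, E) N k F) {f f' : E' → N} {y : E'}
    (h : f =ᶠ[𝓝 y] f') : θ.pullback f y = θ.pullback f' y := by
  ext v
  have h1 : mfderiv 𝓘(ℝ, E') 𝓘(ℝ, E) f y = mfderiv 𝓘(ℝ, E') 𝓘(ℝ, E) f' y := h.mfderiv_eq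
  simp only [DForm.pullback, h1]
  exact θ.apply_congr h.self_of_nhds _

theorem ContMDiffAt.eventually_mdifferentiableAt [IsManifold 𝓘(ℝ, E) ∞ N] {f : E' → N} {y : E'}
    (hf : ContMDiffAt 𝓘(ℝ, E') 𝓘(ℝ, E) ∞ f y) :
    ∀ᶠ z in 𝓝 y, MDifferentiableAt 𝓘(ℝ, E') 𝓘(ℝ, E) f z := by
  have : IsManifold 𝓘(ℝ, E) 1 N := .of_le (n := ∞) (by simp)
  have h1 : ContMDiffAt 𝓘(ℝ, E') 𝓘(ℝ, E) 1 f y := hf.of_le (by simp)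
  filter_upwards [(contMDiffAt_iff_contMDiffAt_nhds (by simp)).1 h1] with z hz
  exact hz.mdifferentiableAt one_ne_zero

theorem IsSmoothForm.contDiffAt_inChart {θ : DForm 𝓘(ℝ, E) N k F} (hθ : IsSmoothForm θ) (p : N)
    {q : N} (hq : q ∈ (chartAt E p).source) :
    ContDiffAt ℝ ∞ (θ.inChart p) (extChartAt 𝓘(ℝ, E) p q) :=
  (hθ p).contDiffAt ((isOpen_extChartAt_target p).mem_nhds
    ((extChartAt 𝓘(ℝ, E) p).map_source (by rwa [extChartAt_source])))

variable [IsManifold 𝓘(ℝ, E) ∞ N]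

/-- The pull-back under `f` is the pull-back under the coordinate expression of `f` of the
coordinate expression of the form. -/
theorem DForm.pullback_eq_inChart (θ : DForm 𝓘(ℝ, E) N k F) {f : E' → N} {y : E'}
    (hf : ContMDiffAt 𝓘(ℝ, E') 𝓘(ℝ, E) ∞ f y) {p : N} (hp : f y ∈ (chartAt E p).source) :
    θ.pullback f =ᶠ[𝓝 y] fun z =>
      (θ.inChart p (extChartAt 𝓘(ℝ, E) p (f z))).compContinuousLinearMap
        (fderiv ℝ (fun z => extChartAt 𝓘(ℝ, E) p (f z)) z) := by
  have : IsManifold 𝓘(ℝ, E) 1 N := .of_le (n := ∞) (by simp)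
  have hsrc : ∀ᶠ z in 𝓝 y, f z ∈ (chartAt E p).source :=
    hf.continuousAt.eventually ((chartAt E p).open_source.mem_nhds hp)
  filter_upwards [hsrc.eventually_nhds, hf.eventually_mdifferentiableAt] with z hz hfz
  have hz0 : f z ∈ (chartAt E p).source := hz.self_of_nhds
  have hzs : f z ∈ (extChartAt 𝓘(ℝ, E) p).source := by rwa [extChartAt_source]
  have hee : (fun w => (extChartAt 𝓘(ℝ, E) p).symm (extChartAt 𝓘(ℝ, E) p (f w))) =ᶠ[𝓝 z] f := by
    filter_upwards [hz] with w hw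
    exact (extChartAt 𝓘(ℝ, E) p).left_inv (by rwa [extChartAt_source])
  have he : MDifferentiableAt 𝓘(ℝ, E') 𝓘(ℝ, E) (fun w => extChartAt 𝓘(ℝ, E) p (f w)) z :=
    (mdifferentiableAt_extChartAt hz0).comp z hfz
  have hsymm : MDifferentiableAt 𝓘(ℝ, E) 𝓘(ℝ, E) (extChartAt 𝓘(ℝ, E) p).symm
      (extChartAt 𝓘(ℝ, E) p (f z)) :=
    ((contMDiffOn_extChartAt_symm (n := 1) p).contMDiffAt
      ((isOpen_extChartAt_target p).mem_nhds
        ((extChartAt 𝓘(ℝ, E) p).map_source hzs))).mdifferentiableAt one_ne_zero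
  rw [← θ.pullback_congr hee, ← mfderiv_eq_fderiv]
  ext v
  have hc := mfderiv_comp z hsymm he
  exact congrArg (θ ((extChartAt 𝓘(ℝ, E) p).symm (extChartAt 𝓘(ℝ, E) p (f z))))
    (funext fun i => congrArg (fun A => A (v i)) hc)

theorem contDiffAt_extChartAt_comp {f : E' → N} {y : E'}
    (hf : ContMDiffAt 𝓘(ℝ, E') 𝓘(ℝ, E) ∞ f y) {p : N} (hp : f y ∈ (chartAt E p).source) :
    ContDiffAt ℝ ∞ (fun z => extChartAt 𝓘(ℝ, E) p (f z)) y :=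
  contMDiffAt_iff_contDiffAt.1 ((contMDiffAt_extChartAt' hp).comp y hf)

theorem IsSmoothForm.contDiffAt_pullback {θ : DForm 𝓘(ℝ, E) N 1 F} (hθ : IsSmoothForm θ)
    {f : E' → N} {y : E'} (hf : ContMDiffAt 𝓘(ℝ, E') 𝓘(ℝ, E) ∞ f y) :
    ContDiffAt ℝ ∞ (θ.pullback f) y := by
  have hp := mem_chart_source E (f y)
  refine ContDiffAt.congr_of_eventuallyEq ?_ (θ.pullback_eq_inChart hf hp)
  have he := contDiffAt_extChartAt_comp hf hp
  have h1 : ContDiffAt ℝ ∞ (fun z => θ.inChart (f y) (extChartAt 𝓘(ℝ, E) (f y) (f z))) y :=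
    ContDiffAt.comp (g := θ.inChart (f y)) y (hθ.contDiffAt_inChart _ hp) he
  have h2 := he.fderiv_right (m := ∞) (by simp)
  let L := ContinuousAlternatingMap.ofSubsingletonLIE (𝕜 := ℝ) (E := E) (F := F) (0 : Fin 1)
  let L' := ContinuousAlternatingMap.ofSubsingletonLIE (𝕜 := ℝ) (E := E') (F := F) (0 : Fin 1)
  have h3 := L'.contDiff.contDiffAt.comp y ((L.symm.contDiff.contDiffAt.comp y h1).clm_comp h2)
  convert h3 using 1
  funext z
  ext v
  have : ∀ A : E [⋀^Fin 1]→L[ℝ] F, A = L (L.symm A) := fun A => (L.apply_symm_apply A).symm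
  show (θ.inChart (f y) (extChartAt 𝓘(ℝ, E) (f y) (f z))) _ = _
  rw [this (θ.inChart (f y) (extChartAt 𝓘(ℝ, E) (f y) (f z)))]
  rfl

/-- The exterior derivative commutes with pull-back. -/
theorem IsSmoothForm.extDeriv_pullback {θ : DForm 𝓘(ℝ, E) N k F} (hθ : IsSmoothForm θ)
    {f : E' → N} {y : E'} (hf : ContMDiffAt 𝓘(ℝ, E') 𝓘(ℝ, E) ∞ f y) :
    extDeriv (θ.pullback f) y = θ.d.pullback f y := by
  have : IsManifold 𝓘(ℝ, E) 1 N := .of_le (n := ∞) (by simp)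
  have hp := mem_chart_source E (f y)
  rw [(θ.pullback_eq_inChart hf hp).extDeriv_eq]
  have he := contDiffAt_extChartAt_comp hf hp
  have hd : DifferentiableAt ℝ (θ.inChart (f y))
      ((fun z => extChartAt 𝓘(ℝ, E) (f y) (f z)) y) :=
    (hθ.contDiffAt_inChart _ hp).differentiableAt (by simp)
  rw [_root_.extDeriv_pullback (f := fun z => extChartAt 𝓘(ℝ, E) (f y) (f z)) (x := y) hd he
    (by simpa only [minSmoothness_of_isRCLikeNormedField] using ENat.LEInfty.out),
    ← mfderiv_eq_fderiv]
  ext v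
  have hc := mfderiv_comp y (mdifferentiableAt_extChartAt (I := 𝓘(ℝ, E)) hp)
    (hf.mdifferentiableAt (by simp))
  exact congrArg (extDeriv (θ.inChart (f y)) (extChartAt 𝓘(ℝ, E) (f y) (f y)))
    (funext fun i => congrArg (fun A => A (v i)) hc)

end Pullback

theorem extDeriv_one_form_apply {E F : Type*} [NormedAddCommGroup E] [NormedSpace ℝ E]
    [NormedAddCommGroup F] [NormedSpace ℝ F] {A : E → E [⋀^Fin 1]→L[ℝ] F} {y : E}
    (hA : DifferentiableAt ℝ A y) (u v : E) :
    extDeriv A y ![u, v] =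
      fderiv ℝ (fun z => A z ![v]) y u - fderiv ℝ (fun z => A z ![u]) y v := by
  have h0 : (0 : Fin 2).removeNth ![u, v] = ![v] := by ext i; fin_cases i; rfl
  have h1 : (1 : Fin 2).removeNth ![u, v] = ![u] := by ext i; fin_cases i; rfl
  rw [extDeriv_apply hA, Fin.sum_univ_two, h0, h1]
  simp [sub_eq_add_neg]

theorem DifferentiableAt.alternating_apply {E F : Type*} [NormedAddCommGroup E] [NormedSpace ℝ E]
    [NormedAddCommGroup F] [NormedSpace ℝ F] {k : ℕ} {E' : Type*} [NormedAddCommGroup E']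
    [NormedSpace ℝ E'] {A : E → E' [⋀^Fin k]→L[ℝ] F} {y : E}
    (hA : DifferentiableAt ℝ A y) (v : Fin k → E') : DifferentiableAt ℝ (fun z => A z v) y :=
  (ContinuousAlternatingMap.apply ℝ E' F v).differentiableAt.comp y hA

/-! ### Forms preserved by maps and by families of maps -/

section Invariance

variable {E : Type*} [NormedAddCommGroup E] [NormedSpace ℝ E]
  {N : Type*} [TopologicalSpace N] [ChartedSpace E N]
  {E' : Type*} [NormedAddCommGroup E'] [NormedSpace ℝ E']
  {k : ℕ} {F : Type*} [NormedAddCommGroup F] [NormedSpace ℝ F]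

/-- The map `φ` preserves the 1-form `θ`, i.e. `φ^* θ = θ`. -/
def DForm.PreservedBy (θ : DForm 𝓘(ℝ, E) N 1 F) (φ : N → N) : Prop :=
  ∀ (p : N) (v : TangentSpace 𝓘(ℝ, E) p),
    θ (φ p) ![mfderiv 𝓘(ℝ, E) 𝓘(ℝ, E) φ p v] = θ p ![v]

theorem DForm.pullback_one_apply (θ : DForm 𝓘(ℝ, E) N 1 F) (f : E' → N) (y v : E') :
    θ.pullback f y ![v] = θ (f y) ![mfderiv 𝓘(ℝ, E') 𝓘(ℝ, E) f y v] := by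
  refine congrArg (θ (f y)) (funext fun i => ?_)
  fin_cases i
  rfl

theorem DForm.pullback_two_apply (θ : DForm 𝓘(ℝ, E) N 2 F) (f : E' → N) (y u v : E') :
    θ.pullback f y ![u, v] =
      θ (f y) ![mfderiv 𝓘(ℝ, E') 𝓘(ℝ, E) f y u, mfderiv 𝓘(ℝ, E') 𝓘(ℝ, E) f y v] := by
  refine congrArg (θ (f y)) (funext fun i => ?_)
  fin_cases i <;> rfl

theorem DForm.PreservedBy.pullback_comp {θ : DForm 𝓘(ℝ, E) N 1 F} {φ : N → N}
    (h : θ.PreservedBy φ) {σ : E' → N} {y : E'}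
    (hφ : MDifferentiableAt 𝓘(ℝ, E) 𝓘(ℝ, E) φ (σ y))
    (hσ : MDifferentiableAt 𝓘(ℝ, E') 𝓘(ℝ, E) σ y) :
    θ.pullback (fun z => φ (σ z)) y = θ.pullback σ y := by
  have hc := mfderiv_comp y hφ hσ
  ext v
  have hv : v = ![v 0] := by ext i; fin_cases i; rfl
  rw [hv, θ.pullback_one_apply, θ.pullback_one_apply]
  exact (congrArg (θ (φ (σ y))) (congrArg (fun A => ![A (v 0)]) hc)).trans (h (σ y) _)

theorem DForm.pullback_comp_apply (θ : DForm 𝓘(ℝ, E) N k F) {E'' : Type*} [NormedAddCommGroup E'']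
    [NormedSpace ℝ E''] {f : E' → N} {g : E'' → E'} {z : E''}
    (hf : MDifferentiableAt 𝓘(ℝ, E') 𝓘(ℝ, E) f (g z)) (hg : DifferentiableAt ℝ g z)
    (v : Fin k → E'') :
    θ.pullback (fun z => f (g z)) z v = θ.pullback f (g z) (fun i => fderiv ℝ g z (v i)) := by
  have hc := mfderiv_comp z hf hg.mdifferentiableAt
  rw [mfderiv_eq_fderiv] at hc
  exact congrArg (θ (f (g z))) (funext fun i => congrArg (fun A => A (v i)) hc)

variable [IsManifold 𝓘(ℝ, E) ∞ N]

theorem contMDiffAt_extChartAt_symm_self (p : N) :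
    ContMDiffAt 𝓘(ℝ, E) 𝓘(ℝ, E) ∞ (extChartAt 𝓘(ℝ, E) p).symm (extChartAt 𝓘(ℝ, E) p p) :=
  (contMDiffOn_extChartAt_symm p).contMDiffAt (extChartAt_target_mem_nhds p)

theorem mfderiv_extChartAt_symm_surjective (p : N) (v : TangentSpace 𝓘(ℝ, E) p) :
    ∃ w : E, mfderiv 𝓘(ℝ, E) 𝓘(ℝ, E) (extChartAt 𝓘(ℝ, E) p).symm (extChartAt 𝓘(ℝ, E) p p) w = v := by
  have : IsManifold 𝓘(ℝ, E) 1 N := .of_le (n := ∞) (by simp)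
  have h := (contMDiffAt_extChartAt_symm_self (E := E) p).mdifferentiableAt (by simp)
  have hid : (fun q => (extChartAt 𝓘(ℝ, E) p).symm (extChartAt 𝓘(ℝ, E) p q)) =ᶠ[𝓝 p] id := by
    filter_upwards [extChartAt_source_mem_nhds (I := 𝓘(ℝ, E)) p] with q hq
    exact (extChartAt 𝓘(ℝ, E) p).left_inv hq
  have hc := mfderiv_comp p h (mdifferentiableAt_extChartAt (I := 𝓘(ℝ, E)) (mem_chart_source E p))
  refine ⟨mfderiv 𝓘(ℝ, E) 𝓘(ℝ, E) (extChartAt 𝓘(ℝ, E) p) p v, ?_⟩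
  have h2 : mfderiv 𝓘(ℝ, E) 𝓘(ℝ, E)
      (fun q => (extChartAt 𝓘(ℝ, E) p).symm (extChartAt 𝓘(ℝ, E) p q)) p =
      mfderiv 𝓘(ℝ, E) 𝓘(ℝ, E) id p := hid.mfderiv_eq
  have h3 := congrArg (fun A : E →L[ℝ] E => A v) (hc.symm.trans (h2.trans mfderiv_id))
  exact h3

/-- If `φ^* θ = θ` then `φ^* dθ = dθ`. -/
theorem DForm.PreservedBy.d_apply {θ : DForm 𝓘(ℝ, E) N 1 F} (hθ : IsSmoothForm θ) {φ : N → N}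
    (h : θ.PreservedBy φ) (hφ : ContMDiff 𝓘(ℝ, E) 𝓘(ℝ, E) ∞ φ)
    (p : N) (u v : TangentSpace 𝓘(ℝ, E) p) :
    θ.d (φ p) ![mfderiv 𝓘(ℝ, E) 𝓘(ℝ, E) φ p u, mfderiv 𝓘(ℝ, E) 𝓘(ℝ, E) φ p v] =
      θ.d p ![u, v] := by
  obtain ⟨u, rfl⟩ := mfderiv_extChartAt_symm_surjective p u
  obtain ⟨v, rfl⟩ := mfderiv_extChartAt_symm_surjective p v
  generalize hσ : ((extChartAt 𝓘(ℝ, E) p).symm : E → N) = σ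
  generalize hy : extChartAt 𝓘(ℝ, E) p p = y
  have hp : σ y = p := by rw [← hσ, ← hy, extChartAt_to_inv]
  have hσs : ContMDiffAt 𝓘(ℝ, E) 𝓘(ℝ, E) ∞ σ y := by
    rw [← hσ, ← hy]; exact contMDiffAt_extChartAt_symm_self p
  clear hσ hy
  subst hp
  have hs : ContMDiffAt 𝓘(ℝ, E) 𝓘(ℝ, E) ∞ (fun z => φ (σ z)) y := (hφ (σ y)).comp y hσs
  have he : θ.pullback (fun z => φ (σ z)) =ᶠ[𝓝 y] θ.pullback σ := by
    filter_upwards [hσs.eventually_mdifferentiableAt] with z hz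
    exact h.pullback_comp ((hφ (σ z)).mdifferentiableAt (by simp)) hz
  have h1 := he.extDeriv_eq
  rw [hθ.extDeriv_pullback hs, hθ.extDeriv_pullback hσs] at h1
  have h2 := congrArg (fun A => A ![u, v]) h1
  simp only [θ.d.pullback_two_apply] at h2
  have hc := mfderiv_comp y ((hφ (σ y)).mdifferentiableAt (by simp))
    (hσs.mdifferentiableAt (by simp))
  rw [← h2]
  exact congrArg (θ.d (φ (σ y))) (congrArg (fun A => ![A u, A v]) hc.symm)

/-- For `f(t, z) = φ t (σ z)`, the `t`-component of `f^* θ` at time `0` is `θ(X)` along `σ`, where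
`X = d/dt|₀ φ t`. -/
theorem DForm.pullback_family_apply_fst (θ : DForm 𝓘(ℝ, E) N 1 F)
    {φ : ℝ → N → N} (h0 : ∀ p, φ 0 p = p) {σ : E' → N} {y : E'}
    (hf : ContMDiffAt 𝓘(ℝ, ℝ × E') 𝓘(ℝ, E) ∞ (fun z : ℝ × E' => φ z.1 (σ z.2)) (0, y)) :
    (fun z : E' => θ.pullback (fun z : ℝ × E' => φ z.1 (σ z.2)) (0, z) ![(1, 0)]) =ᶠ[𝓝 y]
      fun z => θ (σ z) ![mfderiv 𝓘(ℝ, ℝ) 𝓘(ℝ, E) (fun t => φ t (σ z)) 0 (1 : ℝ)] := by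
  have hev : ∀ᶠ z in 𝓝 y,
      MDifferentiableAt 𝓘(ℝ, ℝ × E') 𝓘(ℝ, E) (fun z : ℝ × E' => φ z.1 (σ z.2)) (0, z) :=
    (Continuous.prodMk_right (0 : ℝ)).continuousAt.eventually hf.eventually_mdifferentiableAt
  filter_upwards [hev] with z hz
  have hinl : HasFDerivAt (fun t : ℝ => (t, z)) (.inl ℝ ℝ E') 0 := hasFDerivAt_prodMk_left 0 z
  have := θ.pullback_comp_apply (f := fun z : ℝ × E' => φ z.1 (σ z.2)) (g := fun t : ℝ => (t, z))
    (z := 0) hz hinl.differentiableAt ![1]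
  rw [hinl.fderiv, θ.pullback_one_apply] at this
  have h5 := θ.apply_congr (h0 (σ z)) ![mfderiv 𝓘(ℝ, ℝ) 𝓘(ℝ, E) (fun t => φ t (σ z)) 0 (1 : ℝ)]
  refine Eq.trans ?_ (this.symm.trans h5)
  refine congrArg (θ.pullback (fun z : ℝ × E' => φ z.1 (σ z.2)) (0, z)) (funext fun i => ?_)
  fin_cases i
  rfl

theorem IsSmoothForm.contDiffAt_velocity {θ : DForm 𝓘(ℝ, E) N 1 F} (hθ : IsSmoothForm θ)
    {φ : ℝ → N → N} (h0 : ∀ p, φ 0 p = p) {σ : E' → N} {y : E'}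
    (hf : ContMDiffAt 𝓘(ℝ, ℝ × E') 𝓘(ℝ, E) ∞ (fun z : ℝ × E' => φ z.1 (σ z.2)) (0, y)) :
    ContDiffAt ℝ ∞
      (fun z => θ (σ z) ![mfderiv 𝓘(ℝ, ℝ) 𝓘(ℝ, E) (fun t => φ t (σ z)) 0 (1 : ℝ)]) y := by
  refine ContDiffAt.congr_of_eventuallyEq ?_ (θ.pullback_family_apply_fst h0 hf).symm
  have h1 := (ContinuousAlternatingMap.apply ℝ (ℝ × E') F
    ![((1 : ℝ), (0 : E'))]).contDiff.contDiffAt.comp _ (hθ.contDiffAt_pullback hf)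
  exact h1.comp y (contDiff_prodMk_right (0 : ℝ)).contDiffAt

/-- Cartan's formula `ι_X dθ = L_X θ - d(ι_X θ)` for a family `φ t` of maps which preserve `θ` and
start at the identity: `L_X θ = 0` for `X = d/dt|₀ φ t`. It is stated along a map `σ`. -/
theorem IsSmoothForm.d_velocity_apply {θ : DForm 𝓘(ℝ, E) N 1 F} (hθ : IsSmoothForm θ)
    {φ : ℝ → N → N} (hinv : ∀ t, θ.PreservedBy (φ t))
    (hφ : ∀ t, ContMDiff 𝓘(ℝ, E) 𝓘(ℝ, E) ∞ (φ t)) (h0 : ∀ p, φ 0 p = p)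
    {σ : E' → N} {y : E'} (hσ : ContMDiffAt 𝓘(ℝ, E') 𝓘(ℝ, E) ∞ σ y)
    (hf : ContMDiffAt 𝓘(ℝ, ℝ × E') 𝓘(ℝ, E) ∞ (fun z : ℝ × E' => φ z.1 (σ z.2)) (0, y)) (v : E') :
    θ.d (σ y) ![mfderiv 𝓘(ℝ, ℝ) 𝓘(ℝ, E) (fun t => φ t (σ y)) 0 (1 : ℝ),
        mfderiv 𝓘(ℝ, E') 𝓘(ℝ, E) σ y v] =
      -fderiv ℝ (fun z => θ (σ z) ![mfderiv 𝓘(ℝ, ℝ) 𝓘(ℝ, E) (fun t => φ t (σ z)) 0 (1 : ℝ)]) y v := by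
  set f : ℝ × E' → N := fun z => φ z.1 (σ z.2) with hfdef
  have hinl : ∀ (z : E') (t : ℝ), HasFDerivAt (fun t : ℝ => (t, z)) (.inl ℝ ℝ E') t :=
    fun z t => hasFDerivAt_prodMk_left t z
  have hinr : ∀ (z : E') (t : ℝ), HasFDerivAt (fun z : E' => (t, z)) (.inr ℝ ℝ E') z :=
    fun z t => hasFDerivAt_prodMk_right t z
  have hA := (hθ.contDiffAt_pullback hf).differentiableAt (by simp)
  have key := extDeriv_one_form_apply hA (1, 0) (0, v)
  rw [hθ.extDeriv_pullback hf, θ.d.pullback_two_apply] at key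
  have hfm := hf.eventually_mdifferentiableAt
  have hev' : ∀ᶠ t in 𝓝 (0 : ℝ), MDifferentiableAt 𝓘(ℝ, ℝ × E') 𝓘(ℝ, E) f (t, y) :=
    (Continuous.prodMk_left y).continuousAt.eventually hfm
  -- the `t`-derivative of `(φ t)^* θ` vanishes
  have t1 : fderiv ℝ (fun z => θ.pullback f z ![(0, v)]) (0, y) (1, 0) = 0 := by
    have hd := (hA.alternating_apply ![((0 : ℝ), v)]).hasFDerivAt.comp (0 : ℝ) (hinl y 0)
    have hcst : (fun t : ℝ => θ.pullback f (t, y) ![(0, v)]) =ᶠ[𝓝 0]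
        fun _ => θ.pullback σ y ![v] := by
      filter_upwards [hev'] with t ht
      rw [← (hinv t).pullback_comp ((hφ t (σ y)).mdifferentiableAt (by simp))
        (hσ.mdifferentiableAt (by simp))]
      have := θ.pullback_comp_apply (f := f) (g := fun z : E' => (t, z)) (z := y) ht
        (hinr y t).differentiableAt ![v]
      rw [this, (hinr y t).fderiv]
      refine congrArg (θ.pullback f (t, y)) (funext fun i => ?_)
      fin_cases i
      rfl
    have h2 := hd.fderiv
    have h3 : fderiv ℝ (fun t : ℝ => θ.pullback f (t, y) ![(0, v)]) 0 = 0 := by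
      rw [hcst.fderiv_eq]; simp
    have h4 := congrArg (fun A : ℝ →L[ℝ] F => A 1) (h2.symm.trans h3)
    simpa using h4
  -- restricting to `t = 0` leaves the derivative of `θ(X)`
  have t2 : fderiv ℝ (fun z => θ.pullback f z ![(1, 0)]) (0, y) (0, v) =
      fderiv ℝ (fun z => θ (σ z) ![mfderiv 𝓘(ℝ, ℝ) 𝓘(ℝ, E) (fun t => φ t (σ z)) 0 (1 : ℝ)]) y v := by
    have hd := (hA.alternating_apply ![((1 : ℝ), (0 : E'))]).hasFDerivAt.comp y (hinr y 0)
    have hcst := θ.pullback_family_apply_fst h0 hf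
    have h2 := hd.fderiv
    have h4 := congrArg (fun A : E' →L[ℝ] F => A v) (h2.symm.trans hcst.fderiv_eq)
    simpa using h4
  rw [t1, t2, zero_sub] at key
  rw [← key]
  have hfm0 : MDifferentiableAt 𝓘(ℝ, ℝ × E') 𝓘(ℝ, E) f (0, y) := hf.mdifferentiableAt (by simp)
  have c1 := mfderiv_comp (0 : ℝ) (f := fun t : ℝ => (t, y)) (I' := 𝓘(ℝ, ℝ × E')) hfm0
    (hinl y 0).differentiableAt.mdifferentiableAt
  have c2 := mfderiv_comp y (f := fun z : E' => ((0 : ℝ), z)) (I' := 𝓘(ℝ, ℝ × E')) hfm0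
    (hinr y 0).differentiableAt.mdifferentiableAt
  rw [mfderiv_eq_fderiv, (hinl y 0).fderiv] at c1
  rw [mfderiv_eq_fderiv, (hinr y 0).fderiv] at c2
  have hσ' : (fun z : E' => f (0, z)) = σ := funext fun z => h0 (σ z)
  refine Eq.trans (θ.d.apply_congr (h0 (σ y)).symm _)
    (congrArg (θ.d (φ 0 (σ y))) (funext fun i => ?_))
  fin_cases i
  · exact congrArg (fun A : ℝ →L[ℝ] E => A 1) c1
  · have := congrArg (fun A : E' →L[ℝ] E => A v) c2
    refine Eq.trans ?_ this
    have h6 : (f ∘ fun z : E' => ((0 : ℝ), z)) = σ := hσ'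
    exact congrArg (fun g : E' → N =>
      (show E' →L[ℝ] E from mfderiv 𝓘(ℝ, E') 𝓘(ℝ, E) g y) v) h6.symm

/-- The exterior derivative of a form with imaginary values has imaginary values. -/
theorem IsSmoothForm.re_d_apply {θ : DForm 𝓘(ℝ, E) N 1 ℂ} (hθ : IsSmoothForm θ)
    (h : ∀ (p : N) (v : TangentSpace 𝓘(ℝ, E) p), (θ p ![v]).re = 0)
    (p : N) (u v : TangentSpace 𝓘(ℝ, E) p) : (θ.d p ![u, v]).re = 0 := by
  obtain ⟨u, rfl⟩ := mfderiv_extChartAt_symm_surjective p u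
  obtain ⟨v, rfl⟩ := mfderiv_extChartAt_symm_surjective p v
  have hs := contMDiffAt_extChartAt_symm_self (E := E) p
  have hA := (hθ.contDiffAt_pullback hs).differentiableAt (by simp)
  have key := extDeriv_one_form_apply hA u v
  rw [hθ.extDeriv_pullback hs, θ.d.pullback_two_apply] at key
  have hre : ∀ a b : E, (fderiv ℝ (fun z => θ.pullback (extChartAt 𝓘(ℝ, E) p).symm z ![a])
      (extChartAt 𝓘(ℝ, E) p p) b).re = 0 := by
    intro a b
    have h1 := (Complex.reCLM.hasFDerivAt.comp _ (hA.alternating_apply ![a]).hasFDerivAt).fderiv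
    have h2 : (Complex.reCLM ∘ fun z => θ.pullback (extChartAt 𝓘(ℝ, E) p).symm z ![a]) =
        fun _ => 0 := by
      funext z
      rw [Function.comp, θ.pullback_one_apply]
      exact h _ _
    rw [h2] at h1
    have h3 := congrArg (fun A : E →L[ℝ] ℝ => A b) h1
    simpa using h3.symm
  have key' := congrArg Complex.re key
  rw [Complex.sub_re, hre, hre, sub_zero] at key'
  rw [← key']
  exact congrArg Complex.re (θ.d.apply_congr (extChartAt_to_inv (I := 𝓘(ℝ, E)) p).symm _)

end Invariance

/-! ### The vertical vectors of a principal `Spin^c(n)`-bundle -/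

theorem mfderiv_comp_of_hasFDerivAt {E E' E'' : Type*} [NormedAddCommGroup E] [NormedSpace ℝ E]
    [NormedAddCommGroup E'] [NormedSpace ℝ E'] [NormedAddCommGroup E''] [NormedSpace ℝ E'']
    {N : Type*} [TopologicalSpace N] [ChartedSpace E N] {f : E' → N} {g : E'' → E'} {z : E''}
    {y : E'} {g' : E'' →L[ℝ] E'} (hf : MDifferentiableAt 𝓘(ℝ, E') 𝓘(ℝ, E) f y)
    (hg : HasFDerivAt g g' z) (hy : g z = y) (w : E'') :
    mfderiv 𝓘(ℝ, E'') 𝓘(ℝ, E) (fun z => f (g z)) z w = mfderiv 𝓘(ℝ, E') 𝓘(ℝ, E) f y (g' w) := by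
  subst hy
  have hc := mfderiv_comp z hf hg.differentiableAt.mdifferentiableAt
  rw [mfderiv_eq_fderiv, hg.fderiv] at hc
  exact congrArg (fun A : E'' →L[ℝ] E => A w) hc

section RightAction

variable {n : ℕ} {P : Type*} [MulAction (SpinC n)ᵐᵒᵖ P]

theorem rightAct_one (p : P) : rightAct p (1 : SpinC n) = p := one_smul _ p

theorem rightAct_mul (p : P) (γ δ : SpinC n) :
    rightAct p (γ * δ) = rightAct (rightAct p γ) δ := by
  simp only [rightAct, smul_smul, MulOpposite.op_mul]

theorem SpinC.mk_mul (x y : Spin n) (z w : Circle) :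
    SpinC.mk (x * y) (z * w) = SpinC.mk x z * SpinC.mk y w := rfl

theorem SpinC.mk_one : SpinC.mk (1 : Spin n) 1 = 1 := rfl

theorem SpinC.exists_mk (γ : SpinC n) : ∃ x z, SpinC.mk x z = γ := by
  obtain ⟨⟨x, z⟩, h⟩ := QuotientGroup.mk_surjective γ
  exact ⟨x, z, h⟩

end RightAction

theorem hasDerivAt_circle_exp (r : ℝ) :
    HasDerivAt (fun t : ℝ => (Circle.exp (t * r) : ℂ)) (Complex.I * r) 0 := by
  have h : HasDerivAt (fun t : ℝ => ((t * r : ℝ) : ℂ) * Complex.I) ((r : ℂ) * Complex.I) 0 := by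
    have h1 : HasDerivAt (fun t : ℝ => t * r) r 0 := by
      simpa using (hasDerivAt_id (0 : ℝ)).mul_const r
    exact h1.ofReal_comp.mul_const Complex.I
  simpa [Circle.coe_exp, mul_comm] using h.cexp

theorem contDiff_circle_exp (r : ℝ) : ContDiff ℝ ∞ (fun t : ℝ => (Circle.exp (t * r) : ℂ)) := by
  simp only [Circle.coe_exp]
  exact ((Complex.ofRealCLM.contDiff.comp (contDiff_id.mul contDiff_const)).mul
    contDiff_const).cexp

/-- The velocity at `1` of a curve in `U(1)` lies in `𝔲(1) = iℝ`. -/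
theorem Circle.re_eq_zero_of_hasDerivAt {w : ℝ → Circle} {b : ℂ} (h0 : w 0 = 1)
    (h : HasDerivAt (fun t => (w t : ℂ)) b 0) : b.re = 0 := by
  have h1 : HasDerivAt (fun t => ‖(w t : ℂ)‖ ^ 2) (2 * inner ℝ (w 0 : ℂ) b) 0 := h.norm_sq
  have h2 : (fun t => ‖(w t : ℂ)‖ ^ 2) = fun _ => (1 : ℝ) := by
    funext t
    rw [Circle.norm_coe, one_pow]
  rw [h2] at h1
  have h3 := h1.unique (hasDerivAt_const (0 : ℝ) (1 : ℝ))
  simpa [h0] using h3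

section Principal

variable {n : ℕ} {M : Type*} [TopologicalSpace M] [ChartedSpace (EuclideanSpace ℝ (Fin n)) M]
  {EP : Type*} [NormedAddCommGroup EP] [NormedSpace ℝ EP]
  {P : Type*} [TopologicalSpace P] [ChartedSpace EP P] [MulAction (SpinC n)ᵐᵒᵖ P] {π : P → M}

theorem IsPrincipalSpinC.contMDiffAt_rightAct (h : IsPrincipalSpinC n EP π)
    {E : Type*} [NormedAddCommGroup E] [NormedSpace ℝ E] {H : Type*} [TopologicalSpace H]
    {I : ModelWithCorners ℝ E H} {X : Type*} [TopologicalSpace X] [ChartedSpace H X]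
    {q : X → P} {x : X → Spin n} {z : X → Circle} {a : X}
    (hq : ContMDiffAt I 𝓘(ℝ, EP) ∞ q a)
    (hx : ContMDiffAt I 𝓘(ℝ, Cl n) ∞ (fun b => (x b : Cl n)) a)
    (hz : ContMDiffAt I 𝓘(ℝ, ℂ) ∞ (fun b => (z b : ℂ)) a) :
    ContMDiffAt I 𝓘(ℝ, EP) ∞ (fun b => rightAct (q b) (SpinC.mk (x b) (z b))) a := by
  obtain ⟨W, hW, haW, f, hf, hfW⟩ := h.smooth_rightAct (q a) (x a) (z a)
  have hg := hq.prodMk (hx.prodMk_space hz)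
  have hev : ∀ᶠ b in 𝓝 a, (q b, ((x b : Cl n), (z b : ℂ))) ∈ W :=
    hg.continuousAt.eventually (hW.mem_nhds haW)
  refine ContMDiffAt.congr_of_eventuallyEq
    (((hf.contMDiffAt (hW.mem_nhds haW)).comp a hg)) ?_
  filter_upwards [hev] with b hb
  exact (hfW _ _ _ hb).symm

theorem IsPrincipalSpinC.contMDiff_rightAct (h : IsPrincipalSpinC n EP π) (γ : SpinC n) :
    ContMDiff 𝓘(ℝ, EP) 𝓘(ℝ, EP) ∞ (fun q : P => rightAct q γ) := by
  obtain ⟨x, z, rfl⟩ := γ.exists_mk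
  exact fun q => h.contMDiffAt_rightAct (x := fun _ => x) (z := fun _ => z) contMDiffAt_id
    contMDiffAt_const contMDiffAt_const

/-- The velocity `d/dt|₀ p · [c(t), w(t)]` depends linearly on the velocities of `c` and `w`. -/
theorem IsPrincipalSpinC.exists_orbitVelocity_eq (h : IsPrincipalSpinC n EP π) (p : P) :
    ∃ L : Cl n × ℂ →L[ℝ] EP, ∀ (c : ℝ → Spin n) (w : ℝ → Circle) (ζ : Cl n) (b : ℂ),
      c 0 = 1 → w 0 = 1 → HasDerivAt (fun t => (c t : Cl n)) ζ 0 →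
      HasDerivAt (fun t => (w t : ℂ)) b 0 →
      orbitVelocity (EP := EP) (fun t => SpinC.mk (c t) (w t)) p = L (ζ, b) := by
  obtain ⟨W, hW, haW, f, hf, hfW⟩ := h.smooth_rightAct p 1 1
  have hg : ContMDiffAt 𝓘(ℝ, Cl n × ℂ) 𝓘(ℝ, EP) ∞ (fun a : Cl n × ℂ => f (p, a))
      (((1 : Spin n) : Cl n), ((1 : Circle) : ℂ)) :=
    (hf.contMDiffAt (hW.mem_nhds haW)).comp _ (contMDiffAt_const.prodMk contMDiffAt_id)
  refine ⟨mfderiv 𝓘(ℝ, Cl n × ℂ) 𝓘(ℝ, EP) (fun a : Cl n × ℂ => f (p, a))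
      (((1 : Spin n) : Cl n), ((1 : Circle) : ℂ)), fun c w ζ b hc hw hcd hwd => ?_⟩
  have hd : HasFDerivAt (fun t : ℝ => ((c t : Cl n), (w t : ℂ))) _ 0 :=
    (hcd.prodMk hwd).hasFDerivAt
  have hev : ∀ᶠ t in 𝓝 (0 : ℝ), (p, ((c t : Cl n), (w t : ℂ))) ∈ W := by
    have hcont : ContinuousAt (fun t : ℝ => (p, ((c t : Cl n), (w t : ℂ)))) 0 :=
      continuousAt_const.prodMk hd.continuousAt
    refine hcont.eventually (hW.mem_nhds ?_)
    show (p, ((c 0 : Cl n), (w 0 : ℂ))) ∈ W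
    rwa [hc, hw]
  have he : (fun t : ℝ => rightAct p (SpinC.mk (c t) (w t))) =ᶠ[𝓝 0]
      fun t : ℝ => f (p, ((c t : Cl n), (w t : ℂ))) := by
    filter_upwards [hev] with t ht
    exact (hfW _ _ _ ht).symm
  have h1 := mfderiv_comp_of_hasFDerivAt (hg.mdifferentiableAt (by simp)) hd (by rw [hc, hw]) 1
  have h2 := congrArg (fun A : ℝ →L[ℝ] EP => A 1) (he.mfderiv_eq (I := 𝓘(ℝ, ℝ)) (I' := 𝓘(ℝ, EP)))
  exact h2.trans (h1.trans (congrArg (fun a : Cl n × ℂ =>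
    mfderiv 𝓘(ℝ, Cl n × ℂ) 𝓘(ℝ, EP) (fun a : Cl n × ℂ => f (p, a))
      (((1 : Spin n) : Cl n), ((1 : Circle) : ℂ)) a) (one_smul ℝ (ζ, b))))

variable [IsManifold 𝓘(ℝ, EP) ∞ P]

/-- The kernel of `dπ` consists of the velocities `d/dt|₀ p · [c(t), e^{itr}]`. A curve with a given
velocity at `p` is written in a local trivialization as `q(t) · [c(t), w(t)]` with `q(0) = p` and
`[c(0), w(0)] = 1`; if `dπ` kills the velocity then `q'(0) = 0`. -/
theorem IsPrincipalSpinC.exists_orbitVelocity_of_mem_ker (h : IsPrincipalSpinC n EP π) (p : P)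
    (v : TangentSpace 𝓘(ℝ, EP) p) (hv : mfderiv 𝓘(ℝ, EP) (𝓡 n) π p v = 0) :
    ∃ (c : ℝ → Spin n) (ζ : Cl n) (r : ℝ), RepresentsSpin c ζ ∧
      v = orbitVelocity (EP := EP) (fun t => SpinC.mk (c t) (Circle.exp (t * r))) p := by
  obtain ⟨U, hU, hpU, s, κ, hs, hπs, hsκ, -, hκ⟩ := h.locally_trivial (π p)
  obtain ⟨W, hW, hpW, x, z, hxz, hκxz⟩ := hκ p hpU
  obtain ⟨w₀, hw₀⟩ := mfderiv_extChartAt_symm_surjective p v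
  set e := extChartAt 𝓘(ℝ, EP) p with he
  -- a small ball around the chart image of `p`, on which everything is defined
  have hO : ∀ᶠ y in 𝓝 (e p), y ∈ e.target ∧ e.symm y ∈ W ∩ π ⁻¹' U := by
    refine Filter.Eventually.and (extChartAt_target_mem_nhds p) ?_
    have hc : ContinuousAt e.symm (e p) := (contMDiffAt_extChartAt_symm_self p).continuousAt
    refine hc.eventually ((hW.inter (hU.preimage h.smooth_proj.continuous)).mem_nhds ?_)
    rw [he, extChartAt_to_inv]
    exact ⟨hpW, hpU⟩
  have hline : ∀ᶠ τ in 𝓝 (0 : ℝ), e p + τ • w₀ ∈ e.target ∧ e.symm (e p + τ • w₀) ∈ W ∩ π ⁻¹' U := by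
    have hc : ContinuousAt (fun τ : ℝ => e p + τ • w₀) 0 := by fun_prop
    exact hc.tendsto.eventually (p := fun y => y ∈ e.target ∧ e.symm y ∈ W ∩ π ⁻¹' U)
      (by simpa using hO)
  obtain ⟨ε, hε, hball⟩ := Metric.eventually_nhds_iff.1 hline
  -- a curve with velocity `v` defined for all times: `ρ` is bounded by `ε / 2`, with `ρ'(0) = 1`
  set ρ : ℝ → ℝ := fun t => ε / 2 * Real.sin (t / (ε / 2)) with hρdef
  have hρ0 : ρ 0 = 0 := by simp [hρdef]
  have hρs : ContDiff ℝ ∞ ρ := contDiff_const.mul (Real.contDiff_sin.comp (contDiff_id.div_const _))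
  have hρd : HasDerivAt ρ 1 0 := by
    have h1 : HasDerivAt (fun t : ℝ => t / (ε / 2)) (1 / (ε / 2)) 0 :=
      (hasDerivAt_id (0 : ℝ)).div_const _
    have h2 := (h1.sin).const_mul (ε / 2)
    have h3 : ε / 2 * (Real.cos (0 / (ε / 2)) * (1 / (ε / 2))) = 1 := by
      rw [zero_div, Real.cos_zero]
      field_simp
    rwa [h3] at h2
  have hρb : ∀ t, dist (ρ t) 0 < ε := by
    intro t
    rw [Real.dist_eq, sub_zero, hρdef, abs_mul, abs_of_pos (by positivity)]
    nlinarith [Real.abs_sin_le_one (t / (ε / 2))]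
  set σ : ℝ → P := fun t => e.symm (e p + ρ t • w₀) with hσdef
  have hσ0 : σ 0 = p := by simp [hσdef, hρ0, he]
  have hσm : ∀ t, σ t ∈ W ∧ π (σ t) ∈ U := fun t => (hball (hρb t)).2
  have hσs : ContMDiff 𝓘(ℝ, ℝ) 𝓘(ℝ, EP) ∞ σ := fun t =>
    ContMDiffAt.comp t (((contMDiffOn_extChartAt_symm p).contMDiffAt
      ((isOpen_extChartAt_target p).mem_nhds (hball (hρb t)).1)))
      (contDiff_const.add (hρs.smul contDiff_const)).contMDiff.contMDiffAt
  have hσv : mfderiv 𝓘(ℝ, ℝ) 𝓘(ℝ, EP) σ 0 (1 : ℝ) = v := by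
    have hd : HasFDerivAt (fun t : ℝ => e p + ρ t • w₀) _ 0 :=
      ((hρd.smul_const w₀).const_add (e p)).hasFDerivAt
    have h1 := mfderiv_comp_of_hasFDerivAt (y := e p)
      ((contMDiffAt_extChartAt_symm_self p).mdifferentiableAt (by simp)) hd (by simp [hρ0]) 1
    refine h1.trans (Eq.trans ?_ hw₀)
    exact congrArg (fun a : EP => mfderiv 𝓘(ℝ, EP) 𝓘(ℝ, EP) e.symm (e p) a) (by simp)
  -- the group component of the curve
  have hxzσ : ContDiff ℝ ∞ fun t => ((x (σ t) : Cl n), (z (σ t) : ℂ)) := by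
    refine contMDiff_iff_contDiff.1 fun t => ?_
    exact (hxz.contMDiffAt (hW.mem_nhds (hσm t).1)).comp t (hσs t)
  set c : ℝ → Spin n := fun t => (x p)⁻¹ * x (σ t) with hc
  set w : ℝ → Circle := fun t => (z p)⁻¹ * z (σ t) with hw
  have hcs : ContDiff ℝ ∞ (fun t => (c t : Cl n)) :=
    (LinearMap.toContinuousLinearMap
      (LinearMap.mulLeft ℝ (((x p)⁻¹ : Spin n) : Cl n))).contDiff.comp hxzσ.fst
  have hws : ContDiff ℝ ∞ (fun t => (w t : ℂ)) := by
    simp only [hw, Circle.coe_mul]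
    exact contDiff_const.mul hxzσ.snd
  have hc0 : c 0 = 1 := by simp [hc, hσ0]
  have hw0 : w 0 = 1 := by simp [hw, hσ0]
  have hcd := (hcs.differentiable (by simp) 0).hasDerivAt
  have hwd := (hws.differentiable (by simp) 0).hasDerivAt
  set ζ := deriv (fun t => (c t : Cl n)) 0
  set b := deriv (fun t => (w t : ℂ)) 0
  have hb : b = Complex.I * (b.im : ℝ) := by
    apply Complex.ext <;> simp [Circle.re_eq_zero_of_hasDerivAt hw0 hwd]
  refine ⟨c, ζ, b.im, ⟨hcs, hc0, hcd⟩, ?_⟩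
  obtain ⟨L, hL⟩ := h.exists_orbitVelocity_eq p
  have hvel := hL c (fun t => Circle.exp (t * b.im)) ζ _ hc0 (by simp) hcd
    (hasDerivAt_circle_exp b.im)
  rw [hvel, ← hb, ← hL c w ζ b hc0 hw0 hcd hwd]
  -- the base component of the curve
  set q : P → P := fun p' => rightAct (s (π p')) (SpinC.mk (x p) (z p)) with hq
  have hqp : q p = p := by rw [hq, ← hκxz p hpW]; exact hsκ p hpU
  have hσq : ∀ t, rightAct (q (σ t)) (SpinC.mk (c t) (w t)) = σ t := by
    intro t
    rw [hq, ← rightAct_mul, ← SpinC.mk_mul, hc, hw]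
    simp only [mul_inv_cancel_left]
    rw [← hκxz _ (hσm t).1]
    exact hsκ _ (hσm t).2
  have hsp : ContMDiffAt (𝓡 n) 𝓘(ℝ, EP) ∞ s (π p) := hs.contMDiffAt (hU.mem_nhds hpU)
  have hs' : ContMDiffAt (𝓡 n) 𝓘(ℝ, EP) ∞ (fun y => rightAct (s y) (SpinC.mk (x p) (z p))) (π p) :=
    (h.contMDiff_rightAct _ _).comp _ hsp
  have hqs : ContMDiffAt 𝓘(ℝ, EP) 𝓘(ℝ, EP) ∞ q p := hs'.comp p (h.smooth_proj p)
  have hqv : mfderiv 𝓘(ℝ, EP) 𝓘(ℝ, EP) q p v = 0 := by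
    have h1 := mfderiv_comp_apply p (hs'.mdifferentiableAt (by simp))
      ((h.smooth_proj p).mdifferentiableAt (by simp)) v
    rw [hv] at h1
    exact h1.trans (map_zero _)
  have hqσ : mfderiv 𝓘(ℝ, ℝ) 𝓘(ℝ, EP) (fun t => q (σ t)) 0 (1 : ℝ) = 0 := by
    have h1 := mfderiv_comp_apply_of_eq (0 : ℝ) (hqs.mdifferentiableAt (by simp))
      ((hσs 0).mdifferentiableAt (by simp)) hσ0 (1 : ℝ)
    exact h1.trans ((congrArg (fun a : EP => mfderiv 𝓘(ℝ, EP) 𝓘(ℝ, EP) q p a) hσv).trans hqv)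
  have hqσs : ContMDiffAt 𝓘(ℝ, ℝ) 𝓘(ℝ, EP) ∞ (fun t => q (σ t)) 0 :=
    ContMDiffAt.comp (g := q) (0 : ℝ) (by rw [hσ0]; exact hqs) (hσs 0)
  set Fm : ℝ × ℝ → P := fun a => rightAct (q (σ a.1)) (SpinC.mk (c a.2) (w a.2)) with hFm
  have hFs : MDifferentiableAt 𝓘(ℝ, ℝ × ℝ) 𝓘(ℝ, EP) Fm (0, 0) := by
    refine (h.contMDiffAt_rightAct ?_ ?_ ?_).mdifferentiableAt (by simp)
    · exact ContMDiffAt.comp (g := fun t => q (σ t)) ((0 : ℝ), (0 : ℝ)) hqσs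
        contDiff_fst.contMDiff.contMDiffAt
    · exact (hcs.comp contDiff_snd).contMDiff.contMDiffAt
    · exact (hws.comp contDiff_snd).contMDiff.contMDiffAt
  have e0 := mfderiv_comp_of_hasFDerivAt (g := fun t : ℝ => (t, t)) (z := 0) hFs
    ((hasFDerivAt_id (0 : ℝ)).prodMk (hasFDerivAt_id (0 : ℝ))) rfl 1
  have e1 := mfderiv_comp_of_hasFDerivAt (g := fun t : ℝ => (t, (0 : ℝ))) (z := 0) hFs
    (hasFDerivAt_prodMk_left (0 : ℝ) (0 : ℝ)) rfl 1
  have e2 := mfderiv_comp_of_hasFDerivAt (g := fun t : ℝ => ((0 : ℝ), t)) (z := 0) hFs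
    (hasFDerivAt_prodMk_right (0 : ℝ) (0 : ℝ)) rfl 1
  have f0 : (fun t : ℝ => Fm (t, t)) = σ := funext hσq
  have f1 : (fun t : ℝ => Fm (t, 0)) = fun t => q (σ t) := by
    funext t
    simp only [hFm, hc0, hw0, SpinC.mk_one, rightAct_one]
  have f2 : (fun t : ℝ => Fm (0, t)) = fun t => rightAct p (SpinC.mk (c t) (w t)) := by
    funext t
    simp only [hFm, hσ0, hqp]
  let D : (ℝ → P) → EP := fun f => mfderiv 𝓘(ℝ, ℝ) 𝓘(ℝ, EP) f 0 (1 : ℝ)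
  let A : ℝ × ℝ →L[ℝ] EP := mfderiv 𝓘(ℝ, ℝ × ℝ) 𝓘(ℝ, EP) Fm (0, 0)
  have e0' : D σ = A (1, 1) := f0 ▸ e0
  have e1' : (0 : EP) = A (1, 0) := hqσ.symm.trans ((congrArg D f1).symm.trans e1)
  have e2' : D (fun t => rightAct p (SpinC.mk (c t) (w t))) = A (0, 1) := (congrArg D f2).symm.trans e2
  have hsum : A (1, 1) = A (1, 0) + A (0, 1) := by rw [← map_add]; simp
  refine hσv.symm.trans ?_
  show D σ = D _
  rw [e0', hsum, ← e1', zero_add, ← e2']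

end Principal

/-! ### The curvature form -/

theorem ContinuousAlternatingMap.apply_pair_swap {E F : Type*} [NormedAddCommGroup E]
    [NormedSpace ℝ E] [NormedAddCommGroup F] [NormedSpace ℝ F] (A : E [⋀^Fin 2]→L[ℝ] F) (u v : E) :
    A ![u, v] = -A ![v, u] := by
  have h := A.toAlternatingMap.map_swap ![v, u] (i := 0) (j := 1) (by decide)
  have h2 : ![v, u] ∘ Equiv.swap (0 : Fin 2) 1 = ![u, v] := by
    funext i; fin_cases i <;> rfl
  rw [h2] at h
  exact h

section Curvature

variable {n : ℕ} {M : Type*} [TopologicalSpace M] [ChartedSpace (EuclideanSpace ℝ (Fin n)) M]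
  {EP : Type*} [NormedAddCommGroup EP] [NormedSpace ℝ EP]
  {P : Type*} [TopologicalSpace P] [ChartedSpace EP P] [MulAction (SpinC n)ᵐᵒᵖ P] {π : P → M}

/-- Local sections of a principal bundle, whose orbits exhaust the fibres. -/
theorem IsPrincipalSpinC.exists_section (h : IsPrincipalSpinC n EP π) (x : M) :
    ∃ (U : Set M) (s : M → P), IsOpen U ∧ x ∈ U ∧ ContMDiffOn (𝓡 n) 𝓘(ℝ, EP) ∞ s U ∧
      (∀ y ∈ U, π (s y) = y) ∧ ∀ p, π p ∈ U → ∃ γ : SpinC n, rightAct (s (π p)) γ = p := by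
  obtain ⟨U, hU, hx, s, κ, hs, hπ, hκ, -⟩ := h.locally_trivial x
  exact ⟨U, s, hU, hx, hs, hπ, fun p hp => ⟨κ p, hκ p hp⟩⟩

theorem IsPrincipalSpinC.mfderiv_proj_section (h : IsPrincipalSpinC n EP π) {U : Set M} {s : M → P}
    (hU : IsOpen U) (hs : ContMDiffOn (𝓡 n) 𝓘(ℝ, EP) ∞ s U) (hπ : ∀ y ∈ U, π (s y) = y)
    {x : M} (hx : x ∈ U) (a : EuclideanSpace ℝ (Fin n)) :
    mfderiv 𝓘(ℝ, EP) (𝓡 n) π (s x) (mfderiv (𝓡 n) 𝓘(ℝ, EP) s x a) = a := by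
  have h1 := mfderiv_comp_apply x ((h.smooth_proj (s x)).mdifferentiableAt (by simp))
    ((hs.contMDiffAt (hU.mem_nhds hx)).mdifferentiableAt (by simp)) a
  have h2 : (π ∘ s) =ᶠ[𝓝 x] id := by
    filter_upwards [hU.mem_nhds hx] with y hy using hπ y hy
  have h3 : mfderiv (𝓡 n) (𝓡 n) (π ∘ s) x = mfderiv (𝓡 n) (𝓡 n) id x := h2.mfderiv_eq
  have h4 := congrArg (fun A : EuclideanSpace ℝ (Fin n) →L[ℝ] EuclideanSpace ℝ (Fin n) => A a)
    (h3.trans mfderiv_id)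
  exact h1.symm.trans h4

variable {G : Type*} [Group G] [MulAction G P] {θ : DForm 𝓘(ℝ, EP) P 1 ℂ}

/-- `θ(V_P)` is constant for all `V` in the Lie algebra of `Spin^c(n)`: for the `𝔰𝔭𝔦𝔫(n)`-part by
hypothesis, and for the `𝔲(1)`-part because `θ` is a connection. -/
theorem IsInvariantConnection.exists_apply_orbitVelocity_eq (h : IsPrincipalSpinC n EP π)
    (hθ : IsInvariantConnection n G θ) (hconst : ConstantOnSpin n θ) {c : ℝ → Spin n} {ζ : Cl n}
    (hc : RepresentsSpin c ζ) (r : ℝ) :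
    ∃ a : ℂ, ∀ p : P,
      θ p ![orbitVelocity (fun t => SpinC.mk (c t) (Circle.exp (t * r))) p] = a := by
  obtain ⟨a, ha⟩ := hconst ζ ⟨c, hc⟩
  refine ⟨a + Complex.I * r, fun p => ?_⟩
  obtain ⟨L, hL⟩ := h.exists_orbitVelocity_eq p
  have h1 := hL c (fun t => Circle.exp (t * r)) ζ _ hc.2.1 (by simp) hc.2.2
    (hasDerivAt_circle_exp r)
  have h2 := hL c (fun _ => 1) ζ 0 hc.2.1 rfl hc.2.2 (hasDerivAt_const _ _)
  have h3 := hL (fun _ => 1) (fun t => Circle.exp (t * r)) 0 _ rfl (by simp) (hasDerivAt_const _ _)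
    (hasDerivAt_circle_exp r)
  have h4 : L (ζ, Complex.I * r) = L (ζ, 0) + L (0, Complex.I * r) := by
    rw [← map_add]; simp
  rw [← ha c hc p, ← hθ.vertical r p]
  refine Eq.trans (congrArg (fun a : EP => θ p ![a]) ?_)
    (ContinuousAlternatingMap.vecCons_add (θ p) ![] _ _)
  exact h1.trans (h4.trans (congrArg₂ (· + ·) h2.symm h3.symm))

/-- A curvature form is recovered as `i · s^* dθ` from any local section `s`. -/
theorem IsCurvature.d_section_apply (h : IsPrincipalSpinC n EP π) {Ω : DForm (𝓡 n) M 2 ℝ}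
    (hΩ : IsCurvature π θ Ω) {U : Set M} {s : M → P}
    (hU : IsOpen U) (hs : ContMDiffOn (𝓡 n) 𝓘(ℝ, EP) ∞ s U) (hπ : ∀ y ∈ U, π (s y) = y)
    {x : M} (hx : x ∈ U) (a b : EuclideanSpace ℝ (Fin n)) :
    θ.d (s x) ![mfderiv (𝓡 n) 𝓘(ℝ, EP) s x a, mfderiv (𝓡 n) 𝓘(ℝ, EP) s x b] =
      -Complex.I * ((Ω x ![a, b] : ℝ) : ℂ) := by
  rw [hΩ]
  have h1 := fun a => h.mfderiv_proj_section hU hs hπ hx a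
  refine congrArg (fun r : ℝ => -Complex.I * (r : ℂ)) ?_
  refine (Ω.apply_congr (hπ x hx) _).trans (congrArg (Ω x) ?_)
  exact congrArg₂ (fun a b : EuclideanSpace ℝ (Fin n) => ![a, b]) (h1 a) (h1 b)

theorem IsCurvature.apply_eq (h : IsPrincipalSpinC n EP π) {Ω : DForm (𝓡 n) M 2 ℝ}
    (hΩ : IsCurvature π θ Ω) {U : Set M} {s : M → P}
    (hU : IsOpen U) (hs : ContMDiffOn (𝓡 n) 𝓘(ℝ, EP) ∞ s U) (hπ : ∀ y ∈ U, π (s y) = y)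
    {x : M} (hx : x ∈ U) (a b : EuclideanSpace ℝ (Fin n)) :
    Ω x ![a, b] =
      -(θ.d (s x) ![mfderiv (𝓡 n) 𝓘(ℝ, EP) s x a, mfderiv (𝓡 n) 𝓘(ℝ, EP) s x b]).im := by
  rw [hΩ.d_section_apply h hU hs hπ hx]
  simp

theorem IsCurvature.unique (h : IsPrincipalSpinC n EP π) {Ω Ω' : DForm (𝓡 n) M 2 ℝ}
    (hΩ : IsCurvature π θ Ω) (hΩ' : IsCurvature π θ Ω') : Ω' = Ω := by
  funext x
  obtain ⟨U, s, hU, hx, hs, hπ, -⟩ := h.exists_section x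
  ext m
  have hm : m = ![m 0, m 1] := by funext i; fin_cases i <;> rfl
  rw [hm]
  exact (hΩ'.apply_eq h hU hs hπ hx (m 0) (m 1)).trans
    (hΩ.apply_eq h hU hs hπ hx (m 0) (m 1)).symm

variable [IsManifold 𝓘(ℝ, EP) ∞ P]

/-- `dθ` is horizontal, by Cartan's formula: it vanishes on vertical vectors. -/
theorem IsInvariantConnection.d_apply_eq_zero (h : IsPrincipalSpinC n EP π)
    (hθ : IsInvariantConnection n G θ) (hconst : ConstantOnSpin n θ) (p : P)
    (u v : TangentSpace 𝓘(ℝ, EP) p) (hu : mfderiv 𝓘(ℝ, EP) (𝓡 n) π p u = 0) :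
    θ.d p ![u, v] = 0 := by
  obtain ⟨c, ζ, r, hc, rfl⟩ := h.exists_orbitVelocity_of_mem_ker p u hu
  obtain ⟨a, ha⟩ := hθ.exists_apply_orbitVelocity_eq h hconst hc r
  clear hu
  obtain ⟨v, rfl⟩ := mfderiv_extChartAt_symm_surjective p v
  have hσs := contMDiffAt_extChartAt_symm_self (E := EP) p
  have hp := extChartAt_to_inv (I := 𝓘(ℝ, EP)) p
  generalize ((extChartAt 𝓘(ℝ, EP) p).symm : EP → P) = σ at *
  generalize extChartAt 𝓘(ℝ, EP) p p = y at *
  subst hp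
  have key := hθ.smooth.d_velocity_apply
    (φ := fun t q => rightAct q (SpinC.mk (c t) (Circle.exp (t * r))))
    (fun t => hθ.spinC_invariant _) (fun t => h.contMDiff_rightAct _)
    (fun q => by simp [hc.2.1, SpinC.mk_one, rightAct_one]) hσs
    (h.contMDiffAt_rightAct (hσs.comp ((0 : ℝ), y) contDiff_snd.contMDiff.contMDiffAt)
      (hc.1.comp contDiff_fst).contMDiff.contMDiffAt
      ((contDiff_circle_exp r).comp contDiff_fst).contMDiff.contMDiffAt) v
  refine key.trans ?_
  have hcst : (fun z => θ (σ z) ![mfderiv 𝓘(ℝ, ℝ) 𝓘(ℝ, EP)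
      (fun t : ℝ => rightAct (σ z) (SpinC.mk (c t) (Circle.exp (t * r)))) 0 (1 : ℝ)]) =
      fun _ => a := funext fun z => ha (σ z)
  rw [hcst]
  simp

/-- `dθ(u, v)` depends only on the projections of `u` and `v`. -/
theorem IsInvariantConnection.d_apply_congr (h : IsPrincipalSpinC n EP π)
    (hθ : IsInvariantConnection n G θ) (hconst : ConstantOnSpin n θ) (p : P)
    (u v u' v' : TangentSpace 𝓘(ℝ, EP) p)
    (hu : mfderiv 𝓘(ℝ, EP) (𝓡 n) π p u = mfderiv 𝓘(ℝ, EP) (𝓡 n) π p u')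
    (hv : mfderiv 𝓘(ℝ, EP) (𝓡 n) π p v = mfderiv 𝓘(ℝ, EP) (𝓡 n) π p v') :
    θ.d p ![u, v] = θ.d p ![u', v'] := by
  have h1 : ∀ a b w : TangentSpace 𝓘(ℝ, EP) p,
      mfderiv 𝓘(ℝ, EP) (𝓡 n) π p a = mfderiv 𝓘(ℝ, EP) (𝓡 n) π p b →
      θ.d p ![a, w] = θ.d p ![b, w] := by
    intro a b w hab
    have h2 := hθ.d_apply_eq_zero h hconst p (a - b) w (by rw [map_sub, hab, sub_self])
    have h3 := ContinuousAlternatingMap.map_vecCons_sub (θ.d p) a b ![w]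
    exact sub_eq_zero.1 (h3.symm.trans h2)
  rw [h1 u u' v hu]
  have h4 := ContinuousAlternatingMap.apply_pair_swap (E := EP) (θ.d p) u' v
  have h5 := ContinuousAlternatingMap.apply_pair_swap (E := EP) (θ.d p) u' v'
  exact h4.trans ((congrArg Neg.neg (h1 v v' u' hv)).trans h5.symm)

/-- `dθ(u, v)` is the same at all points of a fibre, for vectors with the same projections. -/
theorem IsInvariantConnection.d_apply_congr_of_rightAct (h : IsPrincipalSpinC n EP π)
    (hθ : IsInvariantConnection n G θ) (hconst : ConstantOnSpin n θ) {p p₀ : P} {γ : SpinC n}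
    (hp : rightAct p₀ γ = p) (u v : TangentSpace 𝓘(ℝ, EP) p) (u₀ v₀ : TangentSpace 𝓘(ℝ, EP) p₀)
    (hu : (mfderiv 𝓘(ℝ, EP) (𝓡 n) π p u : EuclideanSpace ℝ (Fin n)) =
      mfderiv 𝓘(ℝ, EP) (𝓡 n) π p₀ u₀)
    (hv : (mfderiv 𝓘(ℝ, EP) (𝓡 n) π p v : EuclideanSpace ℝ (Fin n)) =
      mfderiv 𝓘(ℝ, EP) (𝓡 n) π p₀ v₀) :
    θ.d p ![u, v] = θ.d p₀ ![u₀, v₀] := by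
  subst hp
  have hR := h.contMDiff_rightAct γ
  rw [← DForm.PreservedBy.d_apply hθ.smooth (hθ.spinC_invariant γ) hR p₀ u₀ v₀]
  have hπR : ∀ w : TangentSpace 𝓘(ℝ, EP) p₀,
      (mfderiv 𝓘(ℝ, EP) (𝓡 n) π (rightAct p₀ γ)
        (mfderiv 𝓘(ℝ, EP) 𝓘(ℝ, EP) (fun q => rightAct q γ) p₀ w) : EuclideanSpace ℝ (Fin n)) =
      mfderiv 𝓘(ℝ, EP) (𝓡 n) π p₀ w := by
    intro w
    have h1 := mfderiv_comp_apply p₀ ((h.smooth_proj (rightAct p₀ γ)).mdifferentiableAt (by simp))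
      ((hR p₀).mdifferentiableAt (by simp)) w
    have h2 : (π ∘ fun q => rightAct q γ) = π := funext fun q => h.proj_rightAct q γ
    refine h1.symm.trans ?_
    exact congrArg (fun f : P → M => (show EP →L[ℝ] EuclideanSpace ℝ (Fin n) from
      mfderiv 𝓘(ℝ, EP) (𝓡 n) f p₀) w) h2
  exact hθ.d_apply_congr h hconst _ _ _ _ _ (hu.trans (hπR u₀).symm) (hv.trans (hπR v₀).symm)

theorem neg_I_mul_neg_im {z : ℂ} (hz : z.re = 0) : -Complex.I * ((-z.im : ℝ) : ℂ) = z := by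
  apply Complex.ext <;> simp [hz]

/-- The form is `i · s^* dθ`, for a choice of a section `s` around each point. As `dθ` has imaginary
values, multiplication by `i` amounts to taking minus the imaginary part. -/
theorem IsInvariantConnection.exists_isCurvature (h : IsPrincipalSpinC n EP π)
    (hθ : IsInvariantConnection n G θ) (hconst : ConstantOnSpin n θ) :
    ∃ Ω : DForm (𝓡 n) M 2 ℝ, IsCurvature π θ Ω := by
  choose U s hU hxU hs hπs hγ using h.exists_section
  refine ⟨fun x => (-Complex.imCLM).compContinuousAlternatingMap
    ((show EP [⋀^Fin 2]→L[ℝ] ℂ from θ.d (s x x)).compContinuousLinearMap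
      (mfderiv (𝓡 n) 𝓘(ℝ, EP) (s x) x)), fun p u v => ?_⟩
  obtain ⟨γ, hγp⟩ := hγ (π p) p (hxU (π p))
  have hsec := fun a => h.mfderiv_proj_section (hU (π p)) (hs (π p)) (hπs (π p)) (hxU (π p)) a
  have key := hθ.d_apply_congr_of_rightAct h hconst hγp u v
    (mfderiv (𝓡 n) 𝓘(ℝ, EP) (s (π p)) (π p) (mfderiv 𝓘(ℝ, EP) (𝓡 n) π p u))
    (mfderiv (𝓡 n) 𝓘(ℝ, EP) (s (π p)) (π p) (mfderiv 𝓘(ℝ, EP) (𝓡 n) π p v))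
    (hsec _).symm (hsec _).symm
  rw [key, ← neg_I_mul_neg_im (hθ.smooth.re_d_apply hθ.imaginary _ _ _)]
  refine congrArg (fun A : Fin 2 → EP => -Complex.I *
    ((-((show EP [⋀^Fin 2]→L[ℝ] ℂ from θ.d (s (π p) (π p))) A).im : ℝ) : ℂ)) (funext fun i => ?_)
  fin_cases i <;> rfl

variable [IsManifold (𝓡 n) ∞ M]

theorem IsCurvature.isSmoothForm (h : IsPrincipalSpinC n EP π) (hθ : IsSmoothForm θ)
    {Ω : DForm (𝓡 n) M 2 ℝ} (hΩ : IsCurvature π θ Ω) : IsSmoothForm Ω := by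
  intro x₀ y hy
  set e := extChartAt (𝓡 n) x₀ with he
  have hes : ∀ z ∈ e.target,
      ContMDiffAt 𝓘(ℝ, EuclideanSpace ℝ (Fin n)) (𝓡 n) ∞ e.symm z := fun z hz =>
    (contMDiffOn_extChartAt_symm x₀).contMDiffAt ((isOpen_extChartAt_target x₀).mem_nhds hz)
  obtain ⟨U, s, hU, hx, hs, hπ, -⟩ := h.exists_section (e.symm y)
  have hσ : ∀ z ∈ e.target, e.symm z ∈ U →
      ContMDiffAt 𝓘(ℝ, EuclideanSpace ℝ (Fin n)) 𝓘(ℝ, EP) ∞ (fun w => s (e.symm w)) z :=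
    fun z hz hzU => (hs.contMDiffAt (hU.mem_nhds hzU)).comp z (hes z hz)
  have hev : ∀ᶠ z in 𝓝 y, z ∈ e.target ∧ e.symm z ∈ U :=
    Filter.Eventually.and ((isOpen_extChartAt_target x₀).mem_nhds hy)
      ((hes y hy).continuousAt.eventually (hU.mem_nhds hx))
  have hloc : Ω.inChart x₀ =ᶠ[𝓝 y] fun z => (-Complex.imCLM).compContinuousAlternatingMap
      (extDeriv (θ.pullback fun w => s (e.symm w)) z) := by
    filter_upwards [hev] with z hz
    ext m
    have hm : m = ![m 0, m 1] := by funext i; fin_cases i <;> rfl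
    rw [hθ.extDeriv_pullback (hσ z hz.1 hz.2), hm, Ω.inChart_eq_pullback, Ω.pullback_two_apply]
    refine (hΩ.apply_eq h hU hs hπ hz.2 _ _).trans ?_
    show _ = -((θ.d.pullback (fun w => s (e.symm w)) z) ![m 0, m 1]).im
    rw [θ.d.pullback_two_apply]
    have hc : ∀ a : EuclideanSpace ℝ (Fin n), mfderiv (𝓡 n) 𝓘(ℝ, EP) (fun w => s (e.symm w)) z a =
        mfderiv (𝓡 n) 𝓘(ℝ, EP) s (e.symm z) (mfderiv (𝓡 n) (𝓡 n) e.symm z a) := fun a =>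
      mfderiv_comp_apply z ((hs.contMDiffAt (hU.mem_nhds hz.2)).mdifferentiableAt (by simp))
        ((hes z hz.1).mdifferentiableAt (by simp)) a
    rw [hc, hc]
  refine ContDiffAt.contDiffWithinAt (ContDiffAt.congr_of_eventuallyEq ?_ hloc)
  have h1 := (hθ.contDiffAt_pullback (hσ y hy hx)).fderiv_right (m := ∞) (by simp)
  have h2 := (ContinuousAlternatingMap.alternatizeUncurryFinCLM ℝ (EuclideanSpace ℝ (Fin n))
    ℂ (n := 1)).contDiff.contDiffAt.comp y h1
  exact (ContinuousLinearMap.compContinuousAlternatingMapCLM ℝ (EuclideanSpace ℝ (Fin n)) ℂ ℝ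
    (Fin 2) (-Complex.imCLM)).contDiff.contDiffAt.comp y h2

end Curvature

/-! ### The moment map -/

section GeneratedFields

variable {EG : Type*} [NormedAddCommGroup EG] [NormedSpace ℝ EG]
  {G : Type*} [TopologicalSpace G] [ChartedSpace EG G] [Group G]
  {E : Type*} [NormedAddCommGroup E] [NormedSpace ℝ E]
  {N : Type*} [TopologicalSpace N] [ChartedSpace E N] [MulAction G N]
  [ContMDiffSMul 𝓘(ℝ, EG) 𝓘(ℝ, E) ∞ G N]

theorem contMDiff_orbit (p : N) : ContMDiff 𝓘(ℝ, EG) 𝓘(ℝ, E) ∞ (fun h : G => h • p) := fun _ =>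
  ContMDiffAt.smul (f := fun h : G => h) (g := fun _ => p) contMDiffAt_id contMDiffAt_const

/-- Every tangent vector is the velocity of a curve. -/
theorem exists_curve_of_tangent [IsManifold 𝓘(ℝ, E) ∞ N] (p : N) (v : TangentSpace 𝓘(ℝ, E) p) :
    ∃ c : ℝ → N, c 0 = p ∧ ContMDiffAt 𝓘(ℝ, ℝ) 𝓘(ℝ, E) ∞ c 0 ∧
      (mfderiv 𝓘(ℝ, ℝ) 𝓘(ℝ, E) c 0 (1 : ℝ) : E) = v := by
  obtain ⟨w, hw⟩ := mfderiv_extChartAt_symm_surjective p v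
  have hs := contMDiffAt_extChartAt_symm_self (E := E) p
  have hd : HasFDerivAt (fun t : ℝ => extChartAt 𝓘(ℝ, E) p p + t • w) _ 0 :=
    (((hasDerivAt_id (0 : ℝ)).smul_const w).const_add _).hasFDerivAt
  have h0 : extChartAt 𝓘(ℝ, E) p p + (0 : ℝ) • w = extChartAt 𝓘(ℝ, E) p p := by simp
  refine ⟨fun t => (extChartAt 𝓘(ℝ, E) p).symm (extChartAt 𝓘(ℝ, E) p p + t • w), ?_, ?_, ?_⟩
  · show (extChartAt 𝓘(ℝ, E) p).symm _ = p
    rw [h0, extChartAt_to_inv]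
  · refine ContMDiffAt.comp (g := (extChartAt 𝓘(ℝ, E) p).symm) (0 : ℝ) (by rw [h0]; exact hs) ?_
    exact (contDiff_const.add (contDiff_id.smul contDiff_const)).contMDiff.contMDiffAt
  · refine (mfderiv_comp_of_hasFDerivAt (hs.mdifferentiableAt (by simp)) hd h0 1).trans
      (Eq.trans ?_ hw)
    exact congrArg (fun a : E => mfderiv 𝓘(ℝ, E) 𝓘(ℝ, E) (extChartAt 𝓘(ℝ, E) p).symm
      (extChartAt 𝓘(ℝ, E) p p) a) (by simp)

/-- Equivariant maps relate the generated vector fields. -/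
theorem generatedField_map {E' : Type*} [NormedAddCommGroup E'] [NormedSpace ℝ E']
    {N' : Type*} [TopologicalSpace N'] [ChartedSpace E' N'] [MulAction G N'] {f : N → N'}
    (hf : ∀ (h : G) (p : N), f (h • p) = h • f p) (p : N)
    (hfd : MDifferentiableAt 𝓘(ℝ, E) 𝓘(ℝ, E') f p) (ξ : GroupLieAlgebra 𝓘(ℝ, EG) G) :
    (generatedField 𝓘(ℝ, EG) 𝓘(ℝ, E') ξ (f p) : E') =
      mfderiv 𝓘(ℝ, E) 𝓘(ℝ, E') f p (generatedField 𝓘(ℝ, EG) 𝓘(ℝ, E) ξ p) := by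
  have h1 := mfderiv_comp_apply_of_eq (1 : G) (f := fun h : G => h • p) hfd
    ((contMDiff_orbit p 1).mdifferentiableAt (by simp)) (one_smul G p) ξ
  refine Eq.trans ?_ h1
  have h2 : (fun h : G => h • f p) = f ∘ fun h : G => h • p := funext fun h => (hf h p).symm
  exact congrArg (fun g : G → N' => (show EG →L[ℝ] E' from mfderiv 𝓘(ℝ, EG) 𝓘(ℝ, E') g 1) ξ) h2

/-- `ξ_N(h • p) = h_*((Ad_{h⁻¹} ξ)_N(p))`. -/
theorem generatedField_smul [LieGroup 𝓘(ℝ, EG) ∞ G] (h : G) (p : N)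
    (ξ : GroupLieAlgebra 𝓘(ℝ, EG) G) :
    (generatedField 𝓘(ℝ, EG) 𝓘(ℝ, E) ξ (h • p) : E) =
      mfderiv 𝓘(ℝ, E) 𝓘(ℝ, E) (fun q : N => h • q) p
        (generatedField 𝓘(ℝ, EG) 𝓘(ℝ, E) (adjointRep 𝓘(ℝ, EG) h⁻¹ ξ) p) := by
  have hconj : ContMDiff 𝓘(ℝ, EG) 𝓘(ℝ, EG) ∞ (fun k : G => h⁻¹ * k * h⁻¹⁻¹) :=
    (contMDiff_const.mul contMDiff_id).mul contMDiff_const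
  have h1 := mfderiv_comp_apply_of_eq (1 : G) (f := fun k : G => h⁻¹ * k * h⁻¹⁻¹)
    (g := fun k : G => k • p) (y := 1)
    ((contMDiff_orbit (EG := EG) (E := E) p 1).mdifferentiableAt (by simp))
    ((hconj 1).mdifferentiableAt (by simp)) (by simp) ξ
  have h2 := mfderiv_comp_apply_of_eq (1 : G)
    (f := (fun k : G => k • p) ∘ fun k : G => h⁻¹ * k * h⁻¹⁻¹) (g := fun q : N => h • q) (y := p)
    (((ContMDiffSMul.contMDiff_const_smul (I := 𝓘(ℝ, EG)) (I' := 𝓘(ℝ, E)) (n := ∞) h)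
      p).mdifferentiableAt (by simp))
    ((((contMDiff_orbit (EG := EG) (E := E) p).comp hconj) 1).mdifferentiableAt (by simp))
    (by simp) ξ
  have h3 : (fun k : G => k • h • p) =
      (fun q : N => h • q) ∘ (fun k : G => k • p) ∘ fun k : G => h⁻¹ * k * h⁻¹⁻¹ := by
    funext k
    simp [smul_smul, mul_assoc]
  refine Eq.trans (congrArg (fun g : G → N =>
    (show EG →L[ℝ] E from mfderiv 𝓘(ℝ, EG) 𝓘(ℝ, E) g 1) ξ) h3) (h2.trans ?_)
  exact congrArg (fun a : E => mfderiv 𝓘(ℝ, E) 𝓘(ℝ, E) (fun q : N => h • q) p a) h1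

end GeneratedFields

section MomentMap

variable {n : ℕ} {M : Type*} [TopologicalSpace M] [ChartedSpace (EuclideanSpace ℝ (Fin n)) M]
  {EG : Type*} [NormedAddCommGroup EG] [NormedSpace ℝ EG]
  {G : Type*} [TopologicalSpace G] [ChartedSpace EG G] [Group G]
  {EP : Type*} [NormedAddCommGroup EP] [NormedSpace ℝ EP]
  {P : Type*} [TopologicalSpace P] [ChartedSpace EP P]
  [MulAction (SpinC n)ᵐᵒᵖ P] [MulAction G P] {π : P → M} {θ : DForm 𝓘(ℝ, EP) P 1 ℂ}

theorem apply_generatedField (θ : DForm 𝓘(ℝ, EP) P 1 ℂ)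
    (ξ : GroupLieAlgebra 𝓘(ℝ, EG) G) (p : P) :
    θ p ![generatedField 𝓘(ℝ, EG) 𝓘(ℝ, EP) ξ p] = Complex.I * phi θ ξ p := by
  rw [phi, ← mul_assoc, mul_neg, Complex.I_mul_I, neg_neg, one_mul]

/-- `φ^ξ` is real-valued. -/
theorem IsInvariantConnection.phi_eq_re (hθ : IsInvariantConnection n G θ)
    (ξ : GroupLieAlgebra 𝓘(ℝ, EG) G) (p : P) : phi θ ξ p = ((phi θ ξ p).re : ℂ) := by
  have h := hθ.imaginary p (generatedField 𝓘(ℝ, EG) 𝓘(ℝ, EP) ξ p)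
  apply Complex.ext <;> simp [phi, h]

variable [ContMDiffSMul 𝓘(ℝ, EG) 𝓘(ℝ, EP) ∞ G P]

theorem IsInvariantConnection.phi_rightAct (h : IsPrincipalSpinC n EP π)
    (hθ : IsInvariantConnection n G θ)
    (hcomm : ∀ (h : G) (p : P) (γ : SpinC n), h • rightAct p γ = rightAct (h • p) γ)
    (ξ : GroupLieAlgebra 𝓘(ℝ, EG) G) (p : P) (γ : SpinC n) :
    phi θ ξ (rightAct p γ) = phi θ ξ p := by
  have h1 := generatedField_map (f := fun q : P => rightAct q γ) (fun k q => (hcomm k q γ).symm) p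
    ((h.contMDiff_rightAct γ p).mdifferentiableAt (by simp)) ξ
  have h2 := hθ.spinC_invariant γ p (generatedField 𝓘(ℝ, EG) 𝓘(ℝ, EP) ξ p)
  exact congrArg (fun a : ℂ => -Complex.I * a)
    ((congrArg (fun a : EP => θ (rightAct p γ) ![a]) h1).trans h2)

theorem IsInvariantConnection.phi_smul [LieGroup 𝓘(ℝ, EG) ∞ G]
    (hθ : IsInvariantConnection n G θ) (h : G) (ξ : GroupLieAlgebra 𝓘(ℝ, EG) G) (p : P) :
    phi θ ξ (h • p) = phi θ (adjointRep 𝓘(ℝ, EG) h⁻¹ ξ) p := by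
  have h1 := generatedField_smul (E := EP) h p ξ
  have h2 := hθ.group_invariant h p
    (generatedField 𝓘(ℝ, EG) 𝓘(ℝ, EP) (adjointRep 𝓘(ℝ, EG) h⁻¹ ξ) p)
  exact congrArg (fun a : ℂ => -Complex.I * a)
    ((congrArg (fun a : EP => θ (h • p) ![a]) h1).trans h2)

/-- `φ^ξ` descends to `M`, linearly in `ξ`. -/
theorem IsInvariantConnection.exists_descent (h : IsPrincipalSpinC n EP π)
    (hθ : IsInvariantConnection n G θ)
    (hcomm : ∀ (h : G) (p : P) (γ : SpinC n), h • rightAct p γ = rightAct (h • p) γ) :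
    ∃ Φ : M → (GroupLieAlgebra 𝓘(ℝ, EG) G →L[ℝ] ℝ),
      ∀ (ξ : GroupLieAlgebra 𝓘(ℝ, EG) G) (p : P), phi θ ξ p = ((Φ (π p) ξ : ℝ) : ℂ) := by
  choose U s hU hxU hs hπs hγ using h.exists_section
  let A : P → EP →L[ℝ] ℂ := fun p =>
    (ContinuousAlternatingMap.ofSubsingleton ℝ EP ℂ (0 : Fin 1)).symm (θ p)
  let D : P → EG →L[ℝ] EP := fun p => mfderiv 𝓘(ℝ, EG) 𝓘(ℝ, EP) (fun k : G => k • p) 1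
  have hA : ∀ p v, A p v = (show EP [⋀^Fin 1]→L[ℝ] ℂ from θ p) ![v] := fun p v =>
    congrArg (θ p) (funext fun i => by fin_cases i; rfl)
  -- `φ^ξ = -i θ(ξ_P)` is the imaginary part of the imaginary number `θ(ξ_P)`
  refine ⟨fun x => Complex.imCLM ∘L A (s x x) ∘L D (s x x), fun ξ p => ?_⟩
  obtain ⟨γ, hγp⟩ := hγ (π p) p (hxU (π p))
  have h1 := hθ.phi_rightAct h hcomm ξ (s (π p) (π p)) γ
  rw [hγp] at h1
  rw [h1, hθ.phi_eq_re]
  have h2 : (phi θ ξ (s (π p) (π p))).re =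
      ((show EP [⋀^Fin 1]→L[ℝ] ℂ from θ (s (π p) (π p))) ![D (s (π p) (π p)) ξ]).im := by
    simp [phi]
    rfl
  rw [h2, ← hA]
  rfl

variable [IsManifold 𝓘(ℝ, EP) ∞ P] [IsManifold (𝓡 n) ∞ M] [LieGroup 𝓘(ℝ, EG) ∞ G]
  [MulAction G M]

/-- The moment map equation `dΦ^ξ = ι_{ξ_M} Ω` is Cartan's formula for `ξ_P`, read off along a local
section. -/
theorem IsInvariantConnection.moment_map (h : IsPrincipalSpinC n EP π)
    (hθ : IsInvariantConnection n G θ) (hequiv : ∀ (k : G) (p : P), π (k • p) = k • π p)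
    {Ω : DForm (𝓡 n) M 2 ℝ} (hΩ : IsCurvature π θ Ω) (ξ : GroupLieAlgebra 𝓘(ℝ, EG) G) {f : M → ℝ}
    (hf : ∀ p : P, phi θ ξ p = ((f (π p) : ℝ) : ℂ)) (x : M) :
    ContMDiffAt (𝓡 n) 𝓘(ℝ, ℝ) ∞ f x ∧ ∀ v : TangentSpace (𝓡 n) x,
      mfderiv (𝓡 n) 𝓘(ℝ, ℝ) f x v = Ω x ![generatedField 𝓘(ℝ, EG) (𝓡 n) ξ x, v] := by
  have : IsManifold 𝓘(ℝ, EG) ∞ G := ContMDiffMul.toIsManifold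
  have : IsManifold (𝓡 n) 1 M := .of_le (n := ∞) (by simp)
  obtain ⟨U, s, hU, hx, hs, hπ, -⟩ := h.exists_section x
  obtain ⟨c, hc0, hcs, hcv⟩ := exists_curve_of_tangent (1 : G) ξ
  have hes := contMDiffAt_extChartAt_symm_self (E := EuclideanSpace ℝ (Fin n)) x
  have hex := extChartAt_to_inv (I := 𝓡 n) x
  have hsurj := mfderiv_extChartAt_symm_surjective (E := EuclideanSpace ℝ (Fin n)) x
  set e := extChartAt (𝓡 n) x with he
  set y := e x with hy
  set σ : EuclideanSpace ℝ (Fin n) → P := fun z => s (e.symm z) with hσ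
  have hss : ContMDiffAt (𝓡 n) 𝓘(ℝ, EP) ∞ s (e.symm y) := by
    rw [hex]; exact hs.contMDiffAt (hU.mem_nhds hx)
  have hσs : ContMDiffAt 𝓘(ℝ, EuclideanSpace ℝ (Fin n)) 𝓘(ℝ, EP) ∞ σ y := hss.comp y hes
  have hφ : ∀ q : P, c 0 • q = q := fun q => by rw [hc0, one_smul]
  have hFs : ContMDiffAt 𝓘(ℝ, ℝ × EuclideanSpace ℝ (Fin n)) 𝓘(ℝ, EP) ∞
      (fun z : ℝ × EuclideanSpace ℝ (Fin n) => c z.1 • σ z.2) (0, y) :=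
    ContMDiffAt.smul (f := fun z : ℝ × EuclideanSpace ℝ (Fin n) => c z.1) (g := fun z => σ z.2)
      (ContMDiffAt.comp (g := c) ((0 : ℝ), y) hcs contDiff_fst.contMDiff.contMDiffAt)
      (ContMDiffAt.comp (g := σ) ((0 : ℝ), y) hσs contDiff_snd.contMDiff.contMDiffAt)
  -- the velocity of `t ↦ c t • q` is `ξ_P(q)`
  have hvel : ∀ q : P, (mfderiv 𝓘(ℝ, ℝ) 𝓘(ℝ, EP) (fun t => c t • q) 0 (1 : ℝ) : EP) =
      generatedField 𝓘(ℝ, EG) 𝓘(ℝ, EP) ξ q := fun q =>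
    (mfderiv_comp_apply_of_eq (0 : ℝ) (g := fun k : G => k • q) (y := 1)
      ((contMDiff_orbit (EG := EG) (E := EP) q 1).mdifferentiableAt (by simp))
      (hcs.mdifferentiableAt (by simp)) hc0 (1 : ℝ)).trans
      (congrArg (fun a : EG => mfderiv 𝓘(ℝ, EG) 𝓘(ℝ, EP) (fun k : G => k • q) 1 a) hcv)
  have hloc : (fun z => θ (σ z) ![mfderiv 𝓘(ℝ, ℝ) 𝓘(ℝ, EP) (fun t => c t • σ z) 0 (1 : ℝ)]) =ᶠ[𝓝 y]
      fun z => Complex.I * ((f (e.symm z) : ℝ) : ℂ) := by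
    have hev : ∀ᶠ z in 𝓝 y, e.symm z ∈ U := hes.continuousAt.eventually (hU.mem_nhds (by rwa [hex]))
    filter_upwards [hev] with z hz
    refine (congrArg (fun a : EP => θ (σ z) ![a]) (hvel (σ z))).trans ?_
    rw [apply_generatedField, hf, hσ, hπ _ hz]
  have hsm := (hθ.smooth.contDiffAt_velocity hφ hFs).congr_of_eventuallyEq hloc.symm
  -- `f` is smooth in the chart, hence smooth
  have hfe : ContDiffAt ℝ ∞ (fun z => f (e.symm z)) y := by
    have h1 := Complex.imCLM.contDiff.contDiffAt.comp y hsm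
    have h2 : (Complex.imCLM ∘ fun z => Complex.I * ((f (e.symm z) : ℝ) : ℂ)) =
        fun z => f (e.symm z) := by
      funext z; simp
    rwa [h2] at h1
  have hfs : ContMDiffAt (𝓡 n) 𝓘(ℝ, ℝ) ∞ f x := by
    refine ContMDiffAt.congr_of_eventuallyEq
      (ContMDiffAt.comp x (contMDiffAt_iff_contDiffAt.2 hfe)
        (contMDiffAt_extChartAt (I := 𝓡 n) (n := ∞) (x := x))) ?_
    filter_upwards [extChartAt_source_mem_nhds (I := 𝓡 n) x] with z hz
    exact congrArg f (e.left_inv hz).symm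
  refine ⟨hfs, fun v => ?_⟩
  obtain ⟨w, hw⟩ := hsurj v
  have key := hθ.smooth.d_velocity_apply (φ := fun t q => c t • q)
    (fun t => hθ.group_invariant (c t))
    (fun t => ContMDiffSMul.contMDiff_const_smul (I := 𝓘(ℝ, EG)) (c t)) hφ hσs hFs w
  rw [hloc.fderiv_eq] at key
  have hfd := (hfe.differentiableAt (by simp)).hasFDerivAt
  have h3 : HasFDerivAt (fun z => Complex.I * ((f (e.symm z) : ℝ) : ℂ)) _ y :=
    (Complex.ofRealCLM.hasFDerivAt.comp y hfd).const_mul Complex.I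
  rw [h3.fderiv] at key
  -- both sides, expressed on `M`
  have h4 : fderiv ℝ (fun z => f (e.symm z)) y w = mfderiv (𝓡 n) 𝓘(ℝ, ℝ) f x v := by
    have h5 := mfderiv_comp_apply_of_eq y (hfs.mdifferentiableAt (by simp))
      (hes.mdifferentiableAt (by simp)) hex w
    rw [← mfderiv_eq_fderiv]
    refine h5.trans ?_
    exact congrArg (fun a : EuclideanSpace ℝ (Fin n) => mfderiv (𝓡 n) 𝓘(ℝ, ℝ) f x a) hw
  have hπσ : π (σ y) = x := by rw [hσ]; show π (s (e.symm y)) = x; rw [hex, hπ x hx]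
  have hgen : (mfderiv 𝓘(ℝ, EP) (𝓡 n) π (σ y)
      (mfderiv 𝓘(ℝ, ℝ) 𝓘(ℝ, EP) (fun t => c t • σ y) 0 (1 : ℝ)) : EuclideanSpace ℝ (Fin n)) =
      generatedField 𝓘(ℝ, EG) (𝓡 n) ξ x := by
    refine (congrArg (fun a : EP => (mfderiv 𝓘(ℝ, EP) (𝓡 n) π (σ y) a : EuclideanSpace ℝ (Fin n)))
      (hvel (σ y))).trans ?_
    refine (generatedField_map hequiv (σ y) ((h.smooth_proj (σ y)).mdifferentiableAt (by simp))
      ξ).symm.trans ?_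
    exact congrArg (fun a : M => (generatedField 𝓘(ℝ, EG) (𝓡 n) ξ a : EuclideanSpace ℝ (Fin n))) hπσ
  have hv : (mfderiv 𝓘(ℝ, EP) (𝓡 n) π (σ y)
      (mfderiv 𝓘(ℝ, EuclideanSpace ℝ (Fin n)) 𝓘(ℝ, EP) σ y w) : EuclideanSpace ℝ (Fin n)) = v := by
    have h6 := mfderiv_comp_apply y (hss.mdifferentiableAt (by simp))
      (hes.mdifferentiableAt (by simp)) w
    refine (congrArg (fun a : EP => (mfderiv 𝓘(ℝ, EP) (𝓡 n) π (σ y) a : EuclideanSpace ℝ (Fin n)))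
      h6).trans ?_
    refine (h.mfderiv_proj_section hU hs hπ (x := e.symm y) (by rwa [hex]) _).trans hw
  have h7 : (show EuclideanSpace ℝ (Fin n) [⋀^Fin 2]→L[ℝ] ℝ from Ω (π (σ y)))
      ![(mfderiv 𝓘(ℝ, EP) (𝓡 n) π (σ y)
        (mfderiv 𝓘(ℝ, ℝ) 𝓘(ℝ, EP) (fun t => c t • σ y) 0 (1 : ℝ)) : EuclideanSpace ℝ (Fin n)),
        (mfderiv 𝓘(ℝ, EP) (𝓡 n) π (σ y)
      (mfderiv 𝓘(ℝ, EuclideanSpace ℝ (Fin n)) 𝓘(ℝ, EP) σ y w) : EuclideanSpace ℝ (Fin n))] =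
      Ω x ![generatedField 𝓘(ℝ, EG) (𝓡 n) ξ x, v] :=
    (Ω.apply_congr hπσ _).trans (congrArg (Ω x)
      (congrArg₂ (fun a b : EuclideanSpace ℝ (Fin n) => ![a, b]) hgen hv))
  have key' := (congrArg (fun r : ℝ => -Complex.I * (r : ℂ)) h7).symm.trans
    ((hΩ (σ y) _ _).symm.trans key)
  have h8 : fderiv ℝ (fun z => f (e.symm z)) y w = Ω x ![generatedField 𝓘(ℝ, EG) (𝓡 n) ξ x, v] := by
    simpa using (congrArg Complex.im key').symm
  exact h4.symm.trans h8

end MomentMap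

end

theorem claim2p1 {n : ℕ}
    -- the compact `n`-dimensional manifold `M`, its metric and its orientation
    {M : Type*} [TopologicalSpace M] [ChartedSpace (EuclideanSpace ℝ (Fin n)) M]
    [IsManifold (𝓡 n) ∞ M] [CompactSpace M] [T2Space M]
    (g : Metric n M) (vol : DForm (𝓡 n) M n ℝ) (hvol : IsOrientation vol)
    -- the Lie group `G` and its action on `M`
    {EG : Type*} [NormedAddCommGroup EG] [NormedSpace ℝ EG] [FiniteDimensional ℝ EG]
    {G : Type*} [TopologicalSpace G] [ChartedSpace EG G] [Group G] [LieGroup 𝓘(ℝ, EG) ∞ G]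
    [MulAction G M] [ContMDiffSMul 𝓘(ℝ, EG) (𝓡 n) ∞ G M]
    (hG : ActsByOrientedIsometries G g vol)
    -- the `G`-equivariant spin^c structure `P → SOF(M) → M`
    {EP : Type*} [NormedAddCommGroup EP] [NormedSpace ℝ EP] [FiniteDimensional ℝ EP]
    {P : Type*} [TopologicalSpace P] [ChartedSpace EP P] [IsManifold 𝓘(ℝ, EP) ∞ P]
    [MulAction (SpinC n)ᵐᵒᵖ P] [MulAction G P] [ContMDiffSMul 𝓘(ℝ, EG) 𝓘(ℝ, EP) ∞ G P]
    (Λ : P → SOF g vol) (hΛ : IsEquivariantSpinCStructure G EP Λ)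
    -- the connection
    (θ : DForm 𝓘(ℝ, EP) P 1 ℂ) (hθ : IsInvariantConnection n G θ) (hconst : ConstantOnSpin n θ) :
    -- `φ^ξ` is `Spin^c(n)`-invariant
    (∀ (ξ : GroupLieAlgebra 𝓘(ℝ, EG) G) (p : P) (γ : SpinC n),
      phi θ ξ (rightAct p γ) = phi θ ξ p) ∧
    -- there is exactly one real two-form `Ω` on `M` with `dθ = π^*(-iΩ)`
    ∃ Ω : DForm (𝓡 n) M 2 ℝ,
      IsSmoothForm Ω ∧ IsCurvature (baseProj Λ) θ Ω ∧
      (∀ Ω' : DForm (𝓡 n) M 2 ℝ, IsCurvature (baseProj Λ) θ Ω' → Ω' = Ω) ∧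
      -- and exactly one map `Φ : M → 𝔤^*` with `φ^ξ = π^* Φ^ξ`
      ∃ Φ : M → (GroupLieAlgebra 𝓘(ℝ, EG) G →L[ℝ] ℝ),
        (∀ (ξ : GroupLieAlgebra 𝓘(ℝ, EG) G) (p : P), phi θ ξ p = ((Φ (baseProj Λ p) ξ : ℝ) : ℂ)) ∧
        (∀ Φ' : M → (GroupLieAlgebra 𝓘(ℝ, EG) G →L[ℝ] ℝ),
          (∀ (ξ : GroupLieAlgebra 𝓘(ℝ, EG) G) (p : P),
            phi θ ξ p = ((Φ' (baseProj Λ p) ξ : ℝ) : ℂ)) → Φ' = Φ) ∧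
        (∀ ξ : GroupLieAlgebra 𝓘(ℝ, EG) G, ContMDiff (𝓡 n) 𝓘(ℝ, ℝ) ∞ (fun x => Φ x ξ)) ∧
        -- `dΦ^ξ = ι_{ξ_M} Ω`
        (∀ (ξ : GroupLieAlgebra 𝓘(ℝ, EG) G) (x : M) (v : TangentSpace (𝓡 n) x),
          mfderiv (𝓡 n) 𝓘(ℝ, ℝ) (fun y => Φ y ξ) x v =
            Ω x ![generatedField 𝓘(ℝ, EG) (𝓡 n) ξ x, v]) ∧
        -- `Φ` is `G`-equivariant
        (∀ (h : G) (x : M), Φ (h • x) = coadjoint 𝓘(ℝ, EG) h (Φ x)) := by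

  have hP := hΛ.principal
  have hproj : ∀ (k : G) (p : P), baseProj Λ (k • p) = k • baseProj Λ p := fun k p =>
    congrArg Bundle.TotalSpace.proj (hΛ.group_equivariant k p 0)
  obtain ⟨Ω, hΩ⟩ := hθ.exists_isCurvature hP hconst
  obtain ⟨Φ, hΦ⟩ := hθ.exists_descent (EG := EG) hP hΛ.commute
  have hsurj : ∀ x : M, ∃ p : P, baseProj Λ p = x := fun x => by
    obtain ⟨U, s, -, hx, -, hπ, -⟩ := hP.exists_section x
    exact ⟨s x, hπ x hx⟩
  have hmom := fun ξ x => hθ.moment_map hP hproj hΩ ξ (f := fun y => Φ y ξ) (hΦ ξ) x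
  refine ⟨hθ.phi_rightAct hP hΛ.commute, Ω, hΩ.isSmoothForm hP hθ.smooth, hΩ,
    fun Ω' hΩ' => hΩ.unique hP hΩ', Φ, hΦ, fun Φ' hΦ' => ?_, fun ξ x => (hmom ξ x).1,
    fun ξ x v => (hmom ξ x).2 v, fun h x => ?_⟩
  · funext x
    obtain ⟨p, rfl⟩ := hsurj x
    ext ξ
    exact Complex.ofReal_injective ((hΦ' ξ p).symm.trans (hΦ ξ p))
  · obtain ⟨p, rfl⟩ := hsurj x
    ext ξ
    rw [← hproj]
    exact Complex.ofReal_injective ((hΦ ξ (h • p)).symm.trans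
      ((hθ.phi_smul h ξ p).trans (hΦ (adjointRep 𝓘(ℝ, EG) h⁻¹ ξ) p)))
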